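/- Let $(\Omega,\mathcal F,\mathbb P)$ be a complete probability space carrying a two-dimensional Brownian motion $W=(W^X,W^Y)$ (with independent components), and let $\mathbb F=(\mathcal F_t)_{t\ge 0}$ be the filtration generated by $W$, augmented with the $\mathbb P$-null sets. Let $\sigma_1,\sigma_2,r,Q_1,Q_2,I>0$ and $\alpha_1,\alpha_2\in\mathbb R$ with $r>\alpha_1\vee\alpha_2$, and put $\delta_i=r-\alpha_i$. For $x,y\in\mathbb R_+=[0,\infty)$ let $$X_t^x=x\,e^{(\alpha_1-\sigma_1^2/2)t+\sigma_1W^X_t},\qquad Y_t^y=y\,e^{(\alpha_2-\sigma_2^2/2)t+\sigma_2W^Y_t}$$ be the geometric Brownian motions solving $dX^x_t=\alpha_1X^x_t\,dt+\sigma_1X^x_t\,dW^X_t$, $X^x_0=x$, and $dY^y_t=\alpha_2Y^y_t\,dt+\sigma_2Y^y_t\,dW^Y_t$, $Y^y_0=y$. Define $$F(x,y)=\mathbb E\Big[\int_0^\infty e^{-rt}(Q_1X_t^x+Q_2Y_t^y)\,dt-I\Big],\qquad V(x,y)=\sup_{\tau}\mathbb E\big[e^{-r\tau}F(X^x_\tau,Y^y_\tau)\big],$$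 where the supremum is over all $\mathbb F$-stopping times $\tau$ with values in $[0,\infty]$ and the payoff is $0$ on $\{\tau=\infty\}$. Define the stopping region and the boundary by $$\mathcal S=\{(x,y)\in\mathbb R_+^2: V(x,y)=F(x,y)\},\qquad b(x)=\sup\{y\in\mathbb R_+: V(x,y)>F(x,y)\}\quad(x\in\mathbb R_+),\quad \sup\emptyset=0.$$ Let $\beta_1$ and $\eta_1$ be the positive roots of $\tfrac12\sigma_1^2\beta(\beta-1)+\alpha_1\beta-r=0$ and $\tfrac12\sigma_2^2\eta(\eta-1)+\alpha_2\eta-r=0$, and let $$x^*=\frac{\beta_1}{(\beta_1-1)Q_1}\,\delta_1I,\qquad y^*=\frac{\eta_1}{(\eta_1-1)Q_2}\,\delta_2I .$$ Then: 1. The problem is well posed: for all $x,y\in\mathbb R_+$ the integrand defining $F(x,y)$ is integrable for $\mathbb P\otimes dt$, the payoff $e^{-r\tau}F(X^x_\tau,Y^y_\tau)$ is integrable for every stopping time $\tau$, and the suprema defining $V(x,y)$ and $b(x)$ are finite. 2. The stopping region $\mathcal S$ is convex, and $\mathcal S=\{(x,y)\in\mathbb R_+^2: y\ge b(x)\}$.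 3. The boundary $b$ is a convex function on $\mathbb R_+$. 4. The boundary $b$ is continuous on $\mathbb R_+$; moreover $b(0)=y^*$, $b(x)<y^*$ for all $x>0$, and $b(x)=0$ for all $x\ge x^*$. -/

import Mathlib

open MeasureTheory ProbabilityTheory Set
open scoped NNReal

noncomputable section

namespace IrreversibleInvestment

/-- A standard two-dimensional Brownian motion `(W^X, W^Y)`: a pair of independent standard real
Brownian motions, indexed by `t ∈ [0, ∞)`. -/
structure PlanarBrownianMotion {Ω : Type*} [MeasurableSpace Ω] (P : Measure Ω) where
  /-- the first component `W^X` -/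
  WX : ℝ≥0 → Ω → ℝ
  /-- the second component `W^Y` -/
  WY : ℝ≥0 → Ω → ℝ
  measurable_WX : ∀ t, Measurable (WX t)
  measurable_WY : ∀ t, Measurable (WY t)
  isBrownian_WX : IsBrownianReal WX P
  isBrownian_WY : IsBrownianReal WY P
  indep : IndepFun (fun ω t => WX t ω) (fun ω t => WY t ω) P

/-- The constants of the model: drifts `α₁, α₂`, volatilities `σ₁, σ₂`, discount rate `r`,
produced quantities `Q₁, Q₂` and sunk investment cost `I`. -/
structure Params where
  α₁ : ℝ
  α₂ : ℝ
  σ₁ : ℝ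
  σ₂ : ℝ
  r : ℝ
  Q₁ : ℝ
  Q₂ : ℝ
  I : ℝ

/-- Geometric Brownian motion started at `x`, driven by `B`: the (unique strong) solution
`Z_t = x exp ((α - σ² / 2) t + σ B_t)` of `dZ = α Z dt + σ Z dB`, `Z_0 = x`. For `x = 0` it is the
process absorbed in `0`. -/
def geomBrownian {Ω : Type*} (α σ : ℝ) (B : ℝ≥0 → Ω → ℝ) (x : ℝ) (t : ℝ≥0) (ω : Ω) : ℝ :=
  x * Real.exp ((α - σ ^ 2 / 2) * t + σ * B t ω)

/-- The profit function `π(x, y) = Q₁ x + Q₂ y`. -/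
def profit (θ : Params) (x y : ℝ) : ℝ := θ.Q₁ * x + θ.Q₂ * y

/-- `β` is a positive solution of `½ σ² β (β - 1) + α β - r = 0`. -/
def IsPositiveCharRoot (α σ r β : ℝ) : Prop :=
  0 < β ∧ 1 / 2 * σ ^ 2 * β * (β - 1) + α * β - r = 0

/-- The one-dimensional investment threshold `β / ((β - 1) Q) · δ I`, where `δ = r - α`. -/
def threshold (α r Q I β : ℝ) : ℝ := β / ((β - 1) * Q) * (r - α) * I

section Model

variable {Ω : Type*} [MeasurableSpace Ω] {P : Measure Ω}

/-- The filtration generated by the two-dimensional Brownian motion, augmented with the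
`P`-null sets: the sets of time `t` are those that agree, up to a `P`-null set, with a set in
`σ(W_s : s ≤ t)`. -/
def brownianFiltration [P.IsComplete] (W : PlanarBrownianMotion P) :
    Filtration ℝ≥0 ‹MeasurableSpace Ω› where
  seq t := eventuallyMeasurableSpace
    (Filtration.natural (fun s ω => (W.WX s ω, W.WY s ω))
      (fun s => ((W.measurable_WX s).prodMk (W.measurable_WY s)).stronglyMeasurable) t) (ae P)
  mono' := by
    rintro s t hst A ⟨B, hB, hAB⟩
    exact ⟨B, Filtration.mono _ hst _ hB, hAB⟩
  le' := by
    rintro t A ⟨B, hB, hAB⟩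
    exact NullMeasurableSet.measurable_of_complete
      ⟨B, Filtration.le _ t _ hB, hAB⟩

/-- The price `X_t^x` of the first product. -/
def priceX (W : PlanarBrownianMotion P) (θ : Params) (x : ℝ) : ℝ≥0 → Ω → ℝ :=
  geomBrownian θ.α₁ θ.σ₁ W.WX x

/-- The price `Y_t^y` of the second product. -/
def priceY (W : PlanarBrownianMotion P) (θ : Params) (y : ℝ) : ℝ≥0 → Ω → ℝ :=
  geomBrownian θ.α₂ θ.σ₂ W.WY y

/-- The discounted revenue rate `e^{-rt} π(X_t^x, Y_t^y)` for `t ≥ 0`. -/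
def discountedRevenue (W : PlanarBrownianMotion P) (θ : Params) (x y t : ℝ) (ω : Ω) : ℝ :=
  Real.exp (-θ.r * t) * profit θ (priceX W θ x t.toNNReal ω) (priceY W θ y t.toNNReal ω)

/-- The net value `F(x, y) = 𝔼[∫₀^∞ e^{-rt} π(X_t^x, Y_t^y) dt - I]` of an immediate investment. -/
def F (W : PlanarBrownianMotion P) (θ : Params) (x y : ℝ) : ℝ :=
  ∫ ω, ((∫ t in Ioi (0 : ℝ), discountedRevenue W θ x y t ω) - θ.I) ∂P

/-- The discounted payoff `e^{-rτ} F(X_τ^x, Y_τ^y)`, which is `0` on `{τ = ∞}`. -/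
def stoppedPayoff (W : PlanarBrownianMotion P) (θ : Params) (x y : ℝ)
    (τ : Ω → WithTop ℝ≥0) (ω : Ω) : ℝ :=
  match τ ω with
  | ⊤ => 0
  | (t : ℝ≥0) => Real.exp (-θ.r * t) * F W θ (priceX W θ x t ω) (priceY W θ y t ω)

/-- The expected profit `𝒥(x, y, τ) = 𝔼[e^{-rτ} F(X_τ^x, Y_τ^y)]`. -/
def J (W : PlanarBrownianMotion P) (θ : Params) (x y : ℝ) (τ : Ω → WithTop ℝ≥0) : ℝ :=
  ∫ ω, stoppedPayoff W θ x y τ ω ∂P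

/-- The set of expected profits `𝒥(x, y, τ)`, as `τ` ranges over all stopping times. -/
def attainableValues [P.IsComplete] (W : PlanarBrownianMotion P) (θ : Params) (x y : ℝ) : Set ℝ :=
  {v | ∃ τ : Ω → WithTop ℝ≥0, IsStoppingTime (brownianFiltration W) τ ∧ v = J W θ x y τ}

/-- The value function `V(x, y) = sup_τ 𝒥(x, y, τ)`. -/
def V [P.IsComplete] (W : PlanarBrownianMotion P) (θ : Params) (x y : ℝ) : ℝ :=
  sSup (attainableValues W θ x y)

/-- The stopping region `𝒮 = {(x, y) ∈ ℝ₊² : V(x, y) = F(x, y)}`. -/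
def stoppingRegion [P.IsComplete] (W : PlanarBrownianMotion P) (θ : Params) : Set (ℝ × ℝ) :=
  {p | 0 ≤ p.1 ∧ 0 ≤ p.2 ∧ V W θ p.1 p.2 = F W θ p.1 p.2}

/-- The section `{y ∈ ℝ₊ : V(x, y) > F(x, y)}` of the continuation region. -/
def continuationSection [P.IsComplete] (W : PlanarBrownianMotion P) (θ : Params) (x : ℝ) : Set ℝ :=
  {y | 0 ≤ y ∧ F W θ x y < V W θ x y}

/-- The boundary `b(x) = sup {y ∈ ℝ₊ : V(x, y) > F(x, y)}`, with `sup ∅ = 0`. -/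
def boundary [P.IsComplete] (W : PlanarBrownianMotion P) (θ : Params) (x : ℝ) : ℝ :=
  sSup (continuationSection W θ x)

end Model

end IrreversibleInvestment

end

/-! The problem is linear in its starting point. Geometric Brownian motion scales with its initial
value, so `F` is affine and, for each fixed stopping time `τ`, so is `(x, y) ↦ J W θ x y τ` (`F_eq`,
`J_eq`). Hence the stopping region, the set where no `τ` beats immediate investment, is the quadrant
intersected with one closed half plane per `τ` (`mem_stoppingRegion_iff`): it is closed and convex.
Discounted prices are supermartingales, so these half planes have nonnegative coefficients and the
region is closed under increasing either coordinate. A set of this kind is the epigraph of its lower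
boundary, which is therefore convex.

Only the axes need real optimal stopping, and there the problem has one product. Above the
threshold, the payoff is dominated by a combination of the two powers that solve the characteristic
equation, tangent to it at the start (`integral_payoff_le_of_threshold_le`). Below it, waiting for
the threshold is strictly better (`exists_integral_payoff_gt_of_lt_threshold`). Both rest on
optional stopping of exponential martingales, which remain martingales in the joint filtration
because the two motions are independent.

The remaining properties of `b` are plane geometry (`IsConvexUpperSet`): convexity gives continuity
inside and strict descent from the axis, closedness gives continuity at `0`. -/

noncomputable section

open Filter Topology

namespace ProbabilityTheory

/-! ### Independence, null sets and measurability along random times -/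

section General

variable {Ω : Type*} {mΩ : MeasurableSpace Ω} {P : Measure Ω}

/-- If `D` is independent of `U` and `(D, U)` is independent of `V`, then `D` is independent of
`(U, V)`. -/
lemma IndepFun.prodMk_right_of_prodMk_left {β γ δ : Type*} [MeasurableSpace β]
    [MeasurableSpace γ] [MeasurableSpace δ] [IsProbabilityMeasure P]
    {D : Ω → β} {U : Ω → γ} {V : Ω → δ}
    (hD : Measurable D) (hU : Measurable U) (hV : Measurable V)
    (h₁ : IndepFun D U P) (h₂ : IndepFun (fun ω => (D ω, U ω)) V P) :
    IndepFun D (fun ω => (U ω, V ω)) P := by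
  have hDU := (indepFun_iff_map_prod_eq_prod_map_map hD.aemeasurable hU.aemeasurable).1 h₁
  have hUV : IndepFun U V P := h₂.comp measurable_snd measurable_id
  have e₁ := (indepFun_iff_map_prod_eq_prod_map_map hU.aemeasurable hV.aemeasurable).1 hUV
  have e₂ := (indepFun_iff_map_prod_eq_prod_map_map (hD.prodMk hU).aemeasurable
    hV.aemeasurable).1 h₂
  rw [indepFun_iff_map_prod_eq_prod_map_map hD.aemeasurable (hU.prodMk hV).aemeasurable, e₁]
  have := Measure.isProbabilityMeasure_map (μ := P) hD.aemeasurable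
  have := Measure.isProbabilityMeasure_map (μ := P) hU.aemeasurable
  have := Measure.isProbabilityMeasure_map (μ := P) hV.aemeasurable
  -- The hypotheses make the law of `((D, U), V)` a triple product; reassociating it gives the
  -- claim.
  have h := (measurePreserving_prodAssoc (P.map D) (P.map U) (P.map V)).map_eq
  rw [← hDU, ← e₂, Measure.map_map (MeasurableEquiv.measurable _)
    ((hD.prodMk hU).prodMk hV)] at h
  exact h

/-- Replacing a set by one that is almost surely equal changes no probability in the product
formula, so augmentation by null sets preserves independence. -/
lemma Indep.eventuallyMeasurableSpace_right {m₁ m₂ : MeasurableSpace Ω}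
    (h : Indep m₁ m₂ P) : Indep m₁ (eventuallyMeasurableSpace m₂ (ae P)) P := by
  rw [Indep_iff] at h ⊢
  rintro s t hs ⟨t', ht', htt'⟩
  rw [measure_congr htt', ← h s t' hs ht']
  exact measure_congr ((EventuallyEq.refl _ s).inter htt')

/-- A measurable process with almost surely continuous paths is indistinguishable from a
measurable process all of whose paths are continuous. -/
lemma exists_continuous_modification {B : ℝ≥0 → Ω → ℝ} (hB : ∀ t, Measurable (B t))
    (hc : ∀ᵐ ω ∂P, Continuous (B · ω)) :
    ∃ C : ℝ≥0 → Ω → ℝ, (∀ ω, Continuous (C · ω)) ∧ Measurable (Function.uncurry C) ∧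
      ∀ᵐ ω ∂P, ∀ t, C t ω = B t ω := by
  obtain ⟨N, hN, hNm, hN0⟩ := exists_measurable_superset_of_null (ae_iff.1 hc)
  have h1 : ∀ t, Measurable (Nᶜ.indicator (B t)) := fun t => (hB t).indicator hNm.compl
  have h2 : ∀ ω, Continuous fun t => Nᶜ.indicator (B t) ω := by
    intro ω
    by_cases h : ω ∈ N
    · simpa [h] using continuous_const
    · have : Continuous (B · ω) := by
        by_contra hcon
        exact h (hN hcon)
      simpa [h] using this
  refine ⟨fun t => Nᶜ.indicator (B t), h2,
    measurable_uncurry_of_continuous_of_measurable h2 h1, ?_⟩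
  filter_upwards [measure_eq_zero_iff_ae_notMem.1 hN0] with ω hω t
  simp [hω]

/-- The value at a random time of a process with almost surely continuous paths is measurable. -/
lemma aestronglyMeasurable_comp_randomTime {B : ℝ≥0 → Ω → ℝ} (hB : ∀ t, Measurable (B t))
    (hc : ∀ᵐ ω ∂P, Continuous (B · ω)) {ρ : Ω → ℝ≥0} (hρ : Measurable ρ) :
    AEStronglyMeasurable (fun ω => B (ρ ω) ω) P := by
  obtain ⟨C, -, hC, hBC⟩ := exists_continuous_modification hB hc
  refine ⟨fun ω => C (ρ ω) ω, (hC.comp (hρ.prodMk measurable_id)).stronglyMeasurable, ?_⟩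
  filter_upwards [hBC] with ω h using (h _).symm

end General

/-! ### Optional stopping in continuous time -/

section OptionalStopping

variable {Ω : Type*} {mΩ : MeasurableSpace Ω} {P : Measure Ω} {ℱ : Filtration ℝ≥0 mΩ}

/-- The smallest point of the grid `ℕ / (n + 1)` above `t`, cut off at `T`. -/
def gridApprox (T : ℝ≥0) (n : ℕ) (t : ℝ≥0) : ℝ≥0 := min T (⌈(n + 1) * t⌉₊ / (n + 1))

lemma gridApprox_le (T : ℝ≥0) (n : ℕ) (t : ℝ≥0) : gridApprox T n t ≤ T := min_le_left _ _

lemma countable_range_gridApprox (T : ℝ≥0) (n : ℕ) (ρ : Ω → ℝ≥0) :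
    (range fun ω => ((gridApprox T n (ρ ω) : ℝ≥0) : WithTop ℝ≥0)).Countable := by
  refine (countable_range fun k : ℕ => ((min T (k / (n + 1)) : ℝ≥0) : WithTop ℝ≥0)).mono ?_
  rintro _ ⟨ω, rfl⟩
  exact ⟨_, rfl⟩

lemma tendsto_gridApprox {T t : ℝ≥0} (ht : t ≤ T) :
    Tendsto (fun n => gridApprox T n t) atTop (𝓝 t) := by
  have h1 : Tendsto (fun n : ℕ => t + 1 / ((n : ℝ≥0) + 1)) atTop (𝓝 t) := by
    simpa using tendsto_const_nhds.add (tendsto_one_div_add_atTop_nhds_zero_nat (𝕜 := ℝ≥0))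
  refine tendsto_of_tendsto_of_tendsto_of_le_of_le tendsto_const_nhds h1 ?_ ?_
  · intro n
    refine le_min ht ?_
    rw [le_div_iff₀ (by positivity), mul_comm]
    exact Nat.le_ceil _
  · intro n
    refine (min_le_right _ _).trans ?_
    have h0 : (n : ℝ≥0) + 1 ≠ 0 := by positivity
    simp only []
    rw [div_le_iff₀ (by positivity), add_mul t, one_div_mul_cancel h0, mul_comm t]
    exact (Nat.ceil_lt_add_one zero_le).le

/-- Before `T`, the rounded-up time is at most `t` exactly when `ρ` is at most the last grid point
before `t`, an event already known at time `t`. -/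
lemma isStoppingTime_gridApprox {ρ : Ω → ℝ≥0}
    (hρ : IsStoppingTime ℱ fun ω => (ρ ω : WithTop ℝ≥0)) (T : ℝ≥0) (n : ℕ) :
    IsStoppingTime ℱ fun ω => ((gridApprox T n (ρ ω) : ℝ≥0) : WithTop ℝ≥0) := by
  intro t
  rcases le_or_gt T t with hTt | hTt
  · convert MeasurableSet.univ
    refine eq_univ_of_forall fun ω => ?_
    exact WithTop.coe_le_coe.2 ((gridApprox_le _ _ _).trans hTt)
  · have hs : ((⌊(n + 1) * t⌋₊ / (n + 1) : ℝ≥0)) ≤ t := by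
      rw [div_le_iff₀ (by positivity), mul_comm t]
      exact Nat.floor_le (zero_le)
    convert ℱ.mono hs _ (hρ (⌊(n + 1) * t⌋₊ / (n + 1) : ℝ≥0)) using 1
    ext ω
    simp only [mem_ofPred_eq, WithTop.coe_le_coe, gridApprox, min_le_iff, hTt.not_ge, false_or]
    rw [div_le_iff₀ (by positivity), le_div_iff₀ (by positivity), mul_comm t, mul_comm (ρ ω),
      ← Nat.le_floor_iff (zero_le), ← Nat.ceil_le]

/-- **Optional stopping** at a bounded stopping time, for a martingale in continuous time with
almost surely continuous paths. -/
theorem _root_.MeasureTheory.Martingale.integrable_and_integral_randomTime_eq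
    [IsProbabilityMeasure P] {M : ℝ≥0 → Ω → ℝ} (hM : Martingale M ℱ P) (hc : ∀ᵐ ω ∂P, Continuous (M · ω)) {ρ : Ω → ℝ≥0}
    (hρ : IsStoppingTime ℱ fun ω => (ρ ω : WithTop ℝ≥0)) {T : ℝ≥0} (hT : ∀ ω, ρ ω ≤ T) :
    Integrable (fun ω => M (ρ ω) ω) P ∧ ∫ ω, M (ρ ω) ω ∂P = ∫ ω, M T ω ∂P := by
  set f : ℕ → Ω → ℝ := fun n ω => M (gridApprox T n (ρ ω)) ω with hf
  have hst := isStoppingTime_gridApprox hρ T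
  have hle : ∀ n ω, ((gridApprox T n (ρ ω) : ℝ≥0) : WithTop ℝ≥0) ≤ T := fun n ω =>
    WithTop.coe_le_coe.2 (gridApprox_le _ _ _)
  -- Optional stopping for countable range exhibits the approximations as conditional expectations
  -- of the single variable `M T`. They are thus uniformly integrable, and Vitali's theorem turns
  -- convergence along continuous paths into convergence in `L¹`.
  have hce : ∀ n, P[M T | (hst n).measurableSpace] =ᵐ[P] f n := fun n =>
    (hM.stoppedValue_ae_eq_condExp_of_le_const_of_countable_range (hst n) (hle n)
      (countable_range_gridApprox T n ρ)).symm
  have hUI : UniformIntegrable f 1 P :=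
    ((hM.integrable T).uniformIntegrable_condExp fun n => (hst n).measurableSpace_le).ae_eq hce
  have hlim : ∀ᵐ ω ∂P, Tendsto (fun n => f n ω) atTop (𝓝 (M (ρ ω) ω)) := by
    filter_upwards [hc] with ω hω
    exact (hω.tendsto _).comp (tendsto_gridApprox (hT ω))
  have hmem : MemLp (fun ω => M (ρ ω) ω) 1 P := hUI.memLp_of_ae_tendsto hlim
  have hL1 := tendsto_Lp_finite_of_tendsto_ae le_rfl ENNReal.one_ne_top hUI.1 hmem hUI.2.1 hlim
  have hint : ∀ n, Integrable (f n) P := fun n => memLp_one_iff_integrable.1 (hUI.memLp n)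
  refine ⟨memLp_one_iff_integrable.1 hmem, tendsto_nhds_unique
    (tendsto_integral_of_L1' _ hmem.1 (.of_forall hint) hL1) ?_⟩
  have : ∀ n, ∫ ω, f n ω ∂P = ∫ ω, M T ω ∂P := fun n => by
    rw [← integral_congr_ae (hce n), integral_condExp]
  simp [this]

/-- The stopping time `min τ T`, as a real-valued function. -/
def cutoff (τ : Ω → WithTop ℝ≥0) (T : ℝ≥0) (ω : Ω) : ℝ≥0 := (min (τ ω) T).untopD 0

lemma coe_cutoff (τ : Ω → WithTop ℝ≥0) (T : ℝ≥0) (ω : Ω) :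
    (cutoff τ T ω : WithTop ℝ≥0) = min (τ ω) T := by
  unfold cutoff
  cases τ ω with
  | top => rw [min_eq_right le_top, WithTop.untopD_coe]
  | coe t => rw [← WithTop.coe_min, WithTop.untopD_coe]

lemma cutoff_le (τ : Ω → WithTop ℝ≥0) (T : ℝ≥0) (ω : Ω) : cutoff τ T ω ≤ T := by
  rw [← WithTop.coe_le_coe, coe_cutoff]
  exact min_le_right _ _

lemma cutoff_of_le {τ : Ω → WithTop ℝ≥0} {T t : ℝ≥0} {ω : Ω} (h : τ ω = t) (htT : t ≤ T) :
    cutoff τ T ω = t := by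
  rw [← WithTop.coe_inj, coe_cutoff, h, min_eq_left (WithTop.coe_le_coe.2 htT)]

lemma cutoff_of_not_le {τ : Ω → WithTop ℝ≥0} {T : ℝ≥0} {ω : Ω} (h : ¬ τ ω ≤ T) :
    cutoff τ T ω = T := by
  rw [← WithTop.coe_inj, coe_cutoff, min_eq_right (not_le.1 h).le]

lemma isStoppingTime_cutoff {τ : Ω → WithTop ℝ≥0} (hτ : IsStoppingTime ℱ τ) (T : ℝ≥0) :
    IsStoppingTime ℱ fun ω => (cutoff τ T ω : WithTop ℝ≥0) := by
  simp_rw [coe_cutoff]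
  exact hτ.min_const T

lemma measurable_of_isStoppingTime_coe {ρ : Ω → ℝ≥0}
    (hρ : IsStoppingTime ℱ fun ω => (ρ ω : WithTop ℝ≥0)) : Measurable ρ := by
  refine measurable_of_Iic fun t => ?_
  convert ℱ.le t _ (hρ t) using 1
  ext ω
  exact (WithTop.coe_le_coe (a := t) (b := ρ ω)).symm

/-- The value `U_τ` of a process at a random time, set to `0` on `{τ = ∞}`. -/
def valueAt (U : ℝ≥0 → Ω → ℝ) (τ : Ω → WithTop ℝ≥0) (ω : Ω) : ℝ :=
  match τ ω with
  | ⊤ => 0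
  | (t : ℝ≥0) => U t ω

lemma valueAt_of_eq_coe {U : ℝ≥0 → Ω → ℝ} {τ : Ω → WithTop ℝ≥0} {ω : Ω} {t : ℝ≥0}
    (h : τ ω = t) : valueAt U τ ω = U t ω := by
  simp only [valueAt, h]

lemma valueAt_of_eq_top {U : ℝ≥0 → Ω → ℝ} {τ : Ω → WithTop ℝ≥0} {ω : Ω}
    (h : τ ω = ⊤) : valueAt U τ ω = 0 := by
  simp only [valueAt, h]

/-- For each `ω` the sequence is eventually constant; the indicator produces the value `0` when `τ`
is infinite. -/
lemma tendsto_indicator_cutoff (U : ℝ≥0 → Ω → ℝ) (τ : Ω → WithTop ℝ≥0) (ω : Ω) :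
    Tendsto (fun n : ℕ => {ω | τ ω ≤ ((n : ℝ≥0) : WithTop ℝ≥0)}.indicator
      (fun ω => U (cutoff τ n ω) ω) ω) atTop (𝓝 (valueAt U τ ω)) := by
  cases h : τ ω with
  | top => simp [valueAt_of_eq_top h, indicator, h]
  | coe t =>
    rw [valueAt_of_eq_coe h]
    refine tendsto_const_nhds.congr' ?_
    obtain ⟨N, hN⟩ := exists_nat_ge t
    filter_upwards [eventually_ge_atTop N] with n hn
    have htn : t ≤ (n : ℝ≥0) := hN.trans (by exact_mod_cast hn)
    rw [indicator_of_mem, cutoff_of_le h htn]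
    simpa [h] using WithTop.coe_le_coe.2 htn

lemma aestronglyMeasurable_valueAt {U : ℝ≥0 → Ω → ℝ} (hU : ∀ t, Measurable (U t))
    (hc : ∀ᵐ ω ∂P, Continuous (U · ω)) {τ : Ω → WithTop ℝ≥0} (hτ : IsStoppingTime ℱ τ) :
    AEStronglyMeasurable (valueAt U τ) P :=
  aestronglyMeasurable_of_tendsto_ae atTop
    (fun n : ℕ => (aestronglyMeasurable_comp_randomTime hU hc
      (measurable_of_isStoppingTime_coe (isStoppingTime_cutoff hτ n))).indicator (ℱ.le _ _ (hτ n)))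
    (.of_forall (tendsto_indicator_cutoff U τ))

/-- **Optional stopping** for a nonnegative process that is dominated by a martingale with almost
surely continuous paths, at a stopping time that may be infinite. -/
theorem integrable_and_integral_valueAt_le [IsProbabilityMeasure P] {M U : ℝ≥0 → Ω → ℝ}
    (hM : Martingale M ℱ P) (hMc : ∀ᵐ ω ∂P, Continuous (M · ω))
    (hU : ∀ t, Measurable (U t)) (hUc : ∀ᵐ ω ∂P, Continuous (U · ω))
    (hU0 : ∀ t ω, 0 ≤ U t ω) (hUM : ∀ t ω, U t ω ≤ M t ω)
    {τ : Ω → WithTop ℝ≥0} (hτ : IsStoppingTime ℱ τ) :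
    Integrable (valueAt U τ) P ∧ ∫ ω, valueAt U τ ω ∂P ≤ ∫ ω, M 0 ω ∂P := by
  have hMT : ∀ T, ∫ ω, M T ω ∂P = ∫ ω, M 0 ω ∂P := fun T => by
    simpa using (hM.setIntegral_eq zero_le MeasurableSet.univ).symm
  have hmeas := aestronglyMeasurable_valueAt (P := P) hU hUc hτ
  have hnn : ∀ ω, 0 ≤ valueAt U τ ω := fun ω => by
    cases h : τ ω with
    | top => rw [valueAt_of_eq_top h]
    | coe t => rw [valueAt_of_eq_coe h]; exact hU0 _ _
  have hlin : ∫⁻ ω, ENNReal.ofReal (valueAt U τ ω) ∂P ≤ ENNReal.ofReal (∫ ω, M 0 ω ∂P) := by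
    have hae : ∀ n : ℕ, AEMeasurable (fun ω => ENNReal.ofReal
        ({ω | τ ω ≤ ((n : ℝ≥0) : WithTop ℝ≥0)}.indicator (fun ω => U (cutoff τ n ω) ω) ω)) P :=
      fun n => ((aestronglyMeasurable_comp_randomTime hU hUc
        (measurable_of_isStoppingTime_coe (isStoppingTime_cutoff hτ n))).indicator
          (ℱ.le _ _ (hτ n))).aemeasurable.ennreal_ofReal
    -- The truncated value is at most `M` at the bounded time `min τ n`, whose mean is that of `M
    -- 0`. Fatou's lemma then passes to the limit, which is why only an inequality survives.
    have key : ∀ n : ℕ, ∫⁻ ω, ENNReal.ofReal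
        ({ω | τ ω ≤ ((n : ℝ≥0) : WithTop ℝ≥0)}.indicator (fun ω => U (cutoff τ n ω) ω) ω) ∂P
          ≤ ENNReal.ofReal (∫ ω, M 0 ω ∂P) := fun n => by
      obtain ⟨h1, h2⟩ := hM.integrable_and_integral_randomTime_eq hMc
        (isStoppingTime_cutoff hτ n) (cutoff_le τ n)
      rw [← hMT n, ← h2, ofReal_integral_eq_lintegral_ofReal h1
        (.of_forall fun ω => (hU0 _ ω).trans (hUM _ ω))]
      refine lintegral_mono fun ω => ENNReal.ofReal_le_ofReal ?_
      exact indicator_le' (fun ω _ => hUM _ ω) (fun ω _ => (hU0 _ ω).trans (hUM _ ω)) ω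
    calc ∫⁻ ω, ENNReal.ofReal (valueAt U τ ω) ∂P
        = ∫⁻ ω, liminf (fun n : ℕ => ENNReal.ofReal ({ω | τ ω ≤ ((n : ℝ≥0) :
            WithTop ℝ≥0)}.indicator (fun ω => U (cutoff τ n ω) ω) ω)) atTop ∂P :=
          lintegral_congr fun ω => ((ENNReal.tendsto_ofReal
            (tendsto_indicator_cutoff U τ ω)).liminf_eq).symm
      _ ≤ _ := lintegral_liminf_le' hae
      _ ≤ _ := liminf_le_of_le (by isBoundedDefault) fun b hb => by
          obtain ⟨n, hn⟩ := hb.exists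
          exact hn.trans (key n)
  have hM0 : 0 ≤ ∫ ω, M 0 ω ∂P := integral_nonneg fun ω => (hU0 0 ω).trans (hUM 0 ω)
  refine ⟨⟨hmeas, ?_⟩, ?_⟩
  · rw [hasFiniteIntegral_iff_ofReal (.of_forall hnn)]
    exact hlin.trans_lt ENNReal.ofReal_lt_top
  · rw [integral_eq_lintegral_of_nonneg_ae (.of_forall hnn) hmeas]
    exact ENNReal.toReal_le_of_le_ofReal hM0 hlin

end OptionalStopping

end ProbabilityTheory

namespace IrreversibleInvestment

/-! ### Exponential martingales of Brownian motion -/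

section ExponentialMartingale

variable {Ω : Type*} {mΩ : MeasurableSpace Ω} {P : Measure Ω} {ℱ : Filtration ℝ≥0 mΩ}

/-- `B` is a Brownian motion relative to the filtration `ℱ`. -/
structure IsBrownianWrt (B : ℝ≥0 → Ω → ℝ) (ℱ : Filtration ℝ≥0 mΩ) (P : Measure Ω) : Prop where
  isBrownian : IsBrownianReal B P
  adapted : ∀ t, Measurable[ℱ t] (B t)
  indep : ∀ s t, s ≤ t →
    Indep (MeasurableSpace.comap (fun ω => B t ω - B s ω) inferInstance) (ℱ s) P

lemma IsBrownianWrt.measurable {B : ℝ≥0 → Ω → ℝ} (hB : IsBrownianWrt B ℱ P) (t : ℝ≥0) :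
    Measurable (B t) := (hB.adapted t).mono (ℱ.le t) le_rfl

/-- The exponential martingale `exp (c B_t - c² t / 2)`. -/
def expMartingale (c : ℝ) (B : ℝ≥0 → Ω → ℝ) (t : ℝ≥0) (ω : Ω) : ℝ :=
  Real.exp (c * B t ω - c ^ 2 / 2 * t)

lemma integrable_exp_mul_of_hasLaw [IsProbabilityMeasure P] {X : Ω → ℝ} {v : ℝ≥0}
    (hX : HasLaw X (gaussianReal 0 v) P) (c : ℝ) :
    Integrable (fun ω => Real.exp (c * X ω)) P ∧
      ∫ ω, Real.exp (c * X ω) ∂P = Real.exp (c ^ 2 / 2 * v) := by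
  have h := mgf_gaussianReal hX.map_eq c
  have hpos : 0 < mgf X P c := by rw [h]; exact Real.exp_pos _
  refine ⟨mgf_pos_iff.1 hpos, ?_⟩
  rw [mgf] at h
  rw [h]
  ring_nf

/-- The value at `t` is the value at `s` times a function of the increment, which is independent of
the past and has mean `1` by the Gaussian moment generating function. -/
lemma IsBrownianWrt.martingale_expMartingale [IsProbabilityMeasure P] {B : ℝ≥0 → Ω → ℝ}
    (hB : IsBrownianWrt B ℱ P) (c : ℝ) : Martingale (expMartingale c B) ℱ P := by
  have hmeas : ∀ t, Measurable[ℱ t] (expMartingale c B t) := fun t =>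
    Real.measurable_exp.comp (((hB.adapted t).const_mul c).sub_const _)
  have hint : ∀ t, Integrable (expMartingale c B t) P := fun t => by
    have := (integrable_exp_mul_of_hasLaw (hB.isBrownian.hasLaw_eval t) c).1.mul_const
      (Real.exp (-(c ^ 2 / 2 * t)))
    refine this.congr (.of_forall fun ω => ?_)
    simp only [expMartingale, ← Real.exp_add, sub_eq_add_neg]
  refine ⟨fun t => (hmeas t).stronglyMeasurable, fun s t hst => ?_⟩
  obtain ⟨hDint, hD⟩ := integrable_exp_mul_of_hasLaw (hB.isBrownian.hasLaw_sub t s) c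
  set g : Ω → ℝ := fun ω =>
    Real.exp (c * (B t - B s) ω) * Real.exp (-(c ^ 2 / 2 * (t - s))) with hg
  have hnn : ((nndist t.1 s.1 : ℝ≥0) : ℝ) = t - s := by
    rw [coe_nndist, Real.dist_eq, abs_of_nonneg]
    · rfl
    · exact sub_nonneg.2 hst
  have hgint : Integrable g P := hDint.mul_const _
  have hg1 : ∫ ω, g ω ∂P = 1 := by
    rw [hg, integral_mul_const, hD, hnn, ← Real.exp_add]
    simp
  have hfac : expMartingale c B t = expMartingale c B s * g := by
    ext ω
    simp only [expMartingale, hg, Pi.mul_apply, Pi.sub_apply, ← Real.exp_add]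
    ring_nf
  have hgm : StronglyMeasurable[MeasurableSpace.comap (fun ω => B t ω - B s ω) inferInstance] g := by
    have h0 := comap_measurable (m := inferInstance) (fun ω => B t ω - B s ω)
    exact ((Real.measurable_exp.comp (h0.const_mul c)).mul_const _).stronglyMeasurable
  have hce := condExp_indep_eq ((hB.measurable t).sub (hB.measurable s)).comap_le (ℱ.le s) hgm
    (hB.indep s t hst)
  rw [hfac]
  refine (condExp_mul_of_stronglyMeasurable_left (hmeas s).stronglyMeasurable
    (hfac ▸ hint t) hgint).trans ?_
  filter_upwards [hce] with ω hω
  rw [Pi.mul_apply, hω, hg1, mul_one]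

lemma IsBrownianWrt.integral_expMartingale [IsProbabilityMeasure P] {B : ℝ≥0 → Ω → ℝ}
    (hB : IsBrownianWrt B ℱ P) (c : ℝ) (t : ℝ≥0) : ∫ ω, expMartingale c B t ω ∂P = 1 := by
  have : expMartingale c B 0 =ᵐ[P] fun _ => 1 := by
    filter_upwards [hB.isBrownian.eval_zero_ae_eq_zero] with ω hω
    simp [expMartingale, hω]
  have h := (hB.martingale_expMartingale c).setIntegral_eq (zero_le (a := t)) MeasurableSet.univ
  rw [setIntegral_univ, setIntegral_univ, integral_congr_ae this] at h
  simpa using h.symm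

lemma IsBrownianWrt.continuous_expMartingale {B : ℝ≥0 → Ω → ℝ}
    (hB : IsBrownianWrt B ℱ P) (c : ℝ) :
    ∀ᵐ ω ∂P, Continuous (expMartingale c B · ω) := by
  filter_upwards [hB.isBrownian.cont] with ω hω
  unfold expMartingale
  fun_prop

end ExponentialMartingale

/-! ### Each component is a Brownian motion for the joint filtration -/

section PlanarBrownianMotion

variable {Ω : Type*} [mΩ : MeasurableSpace Ω] {P : Measure Ω}

/-- An increment of one of two independent Brownian motions is independent of their joint past. -/
lemma indep_increment_past [IsProbabilityMeasure P] {B B' : ℝ≥0 → Ω → ℝ}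
    (hBm : ∀ t, Measurable (B t)) (hBm' : ∀ t, Measurable (B' t)) (hB : IsBrownianReal B P)
    (h : IndepFun (fun ω t => B t ω) (fun ω t => B' t ω) P) {s t : ℝ≥0} (hst : s ≤ t) :
    IndepFun (fun ω => B t ω - B s ω)
      (fun ω => ((fun u : Iic s => B u ω), fun u : ℝ≥0 => B' u ω)) P := by
  -- The increment is independent of its own past by the independence of increments; the increment
  -- and that past together are independent of the entire other path.
  refine IndepFun.prodMk_right_of_prodMk_left ((hBm t).sub (hBm s))
    (measurable_pi_lambda _ fun u => hBm u) (measurable_pi_lambda _ hBm') ?_ ?_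
  · have h1 := hB.indepFun_shift s
    have h2 := h1.comp (measurable_pi_apply (t - s)) measurable_id
    refine h2.congr (.of_forall fun ω => ?_) .rfl
    simp [add_tsub_cancel_of_le hst]
  · have hφ : Measurable fun p : ℝ≥0 → ℝ => (p t - p s, fun u : Iic s => p u) := by
      fun_prop
    exact h.comp hφ measurable_id


lemma adapted_brownianFiltration [P.IsComplete] (W : PlanarBrownianMotion P) (t : ℝ≥0) :
    Measurable[brownianFiltration W t] (fun ω => (W.WX t ω, W.WY t ω)) := by
  refine Measurable.mono ?_ le_eventuallyMeasurableSpace le_rfl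
  exact (Filtration.stronglyAdapted_natural (fun s =>
    ((W.measurable_WX s).prodMk (W.measurable_WY s)).stronglyMeasurable) t).measurable

lemma natural_le_comap (W : PlanarBrownianMotion P) (s : ℝ≥0) {β : Type*} [MeasurableSpace β]
    (f : Ω → β) (hf : ∀ u ≤ s, Measurable[MeasurableSpace.comap f inferInstance]
      (fun ω => (W.WX u ω, W.WY u ω))) :
    Filtration.natural (fun s ω => (W.WX s ω, W.WY s ω))
      (fun s => ((W.measurable_WX s).prodMk (W.measurable_WY s)).stronglyMeasurable) s
      ≤ MeasurableSpace.comap f inferInstance :=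
  iSup₂_le fun u hu => (hf u hu).comap_le

/-- Observing the second motion reveals nothing about future increments of the first. This lets the
one-product estimates apply to stopping times of the joint filtration. -/
lemma isBrownianWrt_WX [IsProbabilityMeasure P] [P.IsComplete] (W : PlanarBrownianMotion P) :
    IsBrownianWrt W.WX (brownianFiltration W) P where
  isBrownian := W.isBrownian_WX
  adapted t := measurable_fst.comp (adapted_brownianFiltration W t)
  indep s t hst := by
    refine Indep.eventuallyMeasurableSpace_right ?_
    refine indep_of_indep_of_le_right
      (indep_increment_past W.measurable_WX W.measurable_WY W.isBrownian_WX W.indep hst)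
      (natural_le_comap W s _ fun u hu => ?_)
    have h0 := comap_measurable (m := inferInstance)
      (fun ω => ((fun u : Iic s => W.WX u ω), fun u : ℝ≥0 => W.WY u ω))
    have h1 : Measurable fun p : (Iic s → ℝ) × (ℝ≥0 → ℝ) => (p.1 ⟨u, hu⟩, p.2 u) := by fun_prop
    exact h1.comp h0

lemma isBrownianWrt_WY [IsProbabilityMeasure P] [P.IsComplete] (W : PlanarBrownianMotion P) :
    IsBrownianWrt W.WY (brownianFiltration W) P where
  isBrownian := W.isBrownian_WY
  adapted t := measurable_snd.comp (adapted_brownianFiltration W t)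
  indep s t hst := by
    refine Indep.eventuallyMeasurableSpace_right ?_
    refine indep_of_indep_of_le_right
      (indep_increment_past W.measurable_WY W.measurable_WX W.isBrownian_WY W.indep.symm hst)
      (natural_le_comap W s _ fun u hu => ?_)
    have h0 := comap_measurable (m := inferInstance)
      (fun ω => ((fun u : Iic s => W.WY u ω), fun u : ℝ≥0 => W.WX u ω))
    have h1 : Measurable fun p : (Iic s → ℝ) × (ℝ≥0 → ℝ) => (p.2 u, p.1 ⟨u, hu⟩) := by fun_prop
    exact h1.comp h0

end PlanarBrownianMotion

/-! ### Discounted powers of geometric Brownian motion -/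

section DiscountedPower

variable {Ω : Type*} {mΩ : MeasurableSpace Ω} {P : Measure Ω} {ℱ : Filtration ℝ≥0 mΩ}

/-- The logarithm `(α - σ² / 2) t + σ B_t` of the geometric Brownian motion started at `1`. -/
def logPrice (α σ : ℝ) (B : ℝ≥0 → Ω → ℝ) (t : ℝ≥0) (ω : Ω) : ℝ :=
  (α - σ ^ 2 / 2) * t + σ * B t ω

/-- The discounted power `e^{-rt} (Z_t)^p` of the geometric Brownian motion `Z` started at `1`. -/
def discountedPower (α σ r p : ℝ) (B : ℝ≥0 → Ω → ℝ) (t : ℝ≥0) (ω : Ω) : ℝ :=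
  Real.exp (p * logPrice α σ B t ω - r * t)

lemma discountedPower_pos (α σ r p : ℝ) (B : ℝ≥0 → Ω → ℝ) (t : ℝ≥0) (ω : Ω) :
    0 < discountedPower α σ r p B t ω := Real.exp_pos _

/-- The growth rate is the characteristic quadratic at `p`: its roots give martingales, negative
values supermartingales. At `p = 1` it is `α - r`, at `p = 0` it is `-r`. -/
lemma discountedPower_eq (α σ r p : ℝ) (B : ℝ≥0 → Ω → ℝ) (t : ℝ≥0) (ω : Ω) :
    discountedPower α σ r p B t ω =
      Real.exp ((1 / 2 * σ ^ 2 * p * (p - 1) + α * p - r) * t) *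
        expMartingale (p * σ) B t ω := by
  rw [discountedPower, expMartingale, logPrice, ← Real.exp_add]
  ring_nf

lemma IsBrownianWrt.measurable_discountedPower {B : ℝ≥0 → Ω → ℝ} (hB : IsBrownianWrt B ℱ P)
    (α σ r p : ℝ) (t : ℝ≥0) : Measurable (discountedPower α σ r p B t) := by
  have := hB.measurable t
  unfold discountedPower logPrice
  fun_prop

lemma IsBrownianWrt.continuous_discountedPower {B : ℝ≥0 → Ω → ℝ} (hB : IsBrownianWrt B ℱ P)
    (α σ r p : ℝ) : ∀ᵐ ω ∂P, Continuous (discountedPower α σ r p B · ω) := by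
  filter_upwards [hB.isBrownian.cont] with ω hω
  unfold discountedPower logPrice
  fun_prop

/-- A discounted power with nonpositive drift is a supermartingale; its expectation at a stopping
time is at most its initial value. -/
lemma IsBrownianWrt.integrable_and_integral_discountedPower_le [IsProbabilityMeasure P]
    {B : ℝ≥0 → Ω → ℝ} (hB : IsBrownianWrt B ℱ P) {α σ r p : ℝ}
    (hp : 1 / 2 * σ ^ 2 * p * (p - 1) + α * p - r ≤ 0)
    {τ : Ω → WithTop ℝ≥0} (hτ : IsStoppingTime ℱ τ) :
    Integrable (valueAt (discountedPower α σ r p B) τ) P ∧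
      ∫ ω, valueAt (discountedPower α σ r p B) τ ω ∂P ≤ 1 := by
  have h := integrable_and_integral_valueAt_le (hB.martingale_expMartingale (p * σ))
    (hB.continuous_expMartingale _) (hB.measurable_discountedPower α σ r p)
    (hB.continuous_discountedPower α σ r p) (fun t ω => (Real.exp_pos _).le) (fun t ω => ?_) hτ
  · rwa [hB.integral_expMartingale] at h
  · rw [discountedPower_eq]
    refine mul_le_of_le_one_left (Real.exp_pos _).le (Real.exp_le_one_iff.2 ?_)
    exact mul_nonpos_of_nonpos_of_nonneg hp t.2

/-- Optional stopping for a discounted power without drift. -/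
lemma IsBrownianWrt.integral_discountedPower_eq_one [IsProbabilityMeasure P]
    {B : ℝ≥0 → Ω → ℝ} (hB : IsBrownianWrt B ℱ P) {α σ r p : ℝ}
    (hp : 1 / 2 * σ ^ 2 * p * (p - 1) + α * p - r = 0)
    {ρ : Ω → ℝ≥0} (hρ : IsStoppingTime ℱ fun ω => (ρ ω : WithTop ℝ≥0)) {T : ℝ≥0}
    (hT : ∀ ω, ρ ω ≤ T) :
    Integrable (fun ω => discountedPower α σ r p B (ρ ω) ω) P ∧
      ∫ ω, discountedPower α σ r p B (ρ ω) ω ∂P = 1 := by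
  have hM := hB.martingale_expMartingale (p * σ)
  have h := hM.integrable_and_integral_randomTime_eq
    (hB.continuous_expMartingale _) hρ hT
  rw [hB.integral_expMartingale] at h
  have he : ∀ t ω, discountedPower α σ r p B t ω = expMartingale (p * σ) B t ω := fun t ω => by
    rw [discountedPower_eq, hp, zero_mul, Real.exp_zero, one_mul]
  simpa only [he] using h

lemma IsBrownianWrt.aestronglyMeasurable_prod_discountedPower [SFinite P]
    {B : ℝ≥0 → Ω → ℝ} (hB : IsBrownianWrt B ℱ P) (α σ r p : ℝ) (μ : Measure ℝ) [SFinite μ] :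
    AEStronglyMeasurable (fun q : Ω × ℝ => discountedPower α σ r p B q.2.toNNReal q.1)
      (P.prod μ) := by
  obtain ⟨C, -, hC, hBC⟩ := exists_continuous_modification
    (hB.measurable_discountedPower α σ r p) (hB.continuous_discountedPower α σ r p)
  refine ⟨fun q => C q.2.toNNReal q.1, Measurable.stronglyMeasurable ?_, ?_⟩
  · exact hC.comp ((measurable_real_toNNReal.comp measurable_snd).prodMk measurable_fst)
  · filter_upwards [Measure.quasiMeasurePreserving_fst.ae hBC] with q hq using (hq _).symm

lemma IsBrownianWrt.integrable_and_integral_discountedPower_one [IsProbabilityMeasure P]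
    {B : ℝ≥0 → Ω → ℝ} (hB : IsBrownianWrt B ℱ P) (α σ r : ℝ) (t : ℝ≥0) :
    Integrable (discountedPower α σ r 1 B t) P ∧
      ∫ ω, discountedPower α σ r 1 B t ω ∂P = Real.exp ((α - r) * t) := by
  have he : discountedPower α σ r 1 B t = fun ω => Real.exp ((α - r) * t) *
      expMartingale (1 * σ) B t ω := by
    ext ω
    rw [discountedPower_eq]
    ring_nf
  rw [he]
  exact ⟨((hB.martingale_expMartingale (1 * σ)).integrable t).const_mul _,
    by rw [integral_const_mul, hB.integral_expMartingale, mul_one]⟩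

lemma IsBrownianWrt.integral_discountedPower_one_toNNReal [IsProbabilityMeasure P]
    {B : ℝ≥0 → Ω → ℝ} (hB : IsBrownianWrt B ℱ P) (α σ r : ℝ) {t : ℝ} (ht : t ∈ Ioi (0 : ℝ)) :
    ∫ ω, discountedPower α σ r 1 B t.toNNReal ω ∂P = Real.exp ((α - r) * t) := by
  rw [(hB.integrable_and_integral_discountedPower_one α σ r t.toNNReal).2,
    Real.coe_toNNReal t (le_of_lt ht)]

/-- The discounted value `e^{-rt} Z_t` is integrable for `P ⊗ dt`. -/
lemma IsBrownianWrt.integrable_prod_discountedPower [IsProbabilityMeasure P]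
    {B : ℝ≥0 → Ω → ℝ} (hB : IsBrownianWrt B ℱ P) {α σ r : ℝ} (hr : α < r) :
    Integrable (fun q : Ω × ℝ => discountedPower α σ r 1 B q.2.toNNReal q.1)
      (P.prod (volume.restrict (Ioi (0 : ℝ)))) := by
  rw [integrable_prod_iff' (hB.aestronglyMeasurable_prod_discountedPower α σ r 1 _)]
  refine ⟨.of_forall fun t =>
    (hB.integrable_and_integral_discountedPower_one α σ r t.toNNReal).1, ?_⟩
  refine IntegrableOn.congr_fun (integrableOn_exp_mul_Ioi (sub_neg.2 hr) 0) (fun t ht => ?_)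
    measurableSet_Ioi
  rw [← hB.integral_discountedPower_one_toNNReal α σ r ht]
  refine integral_congr_ae (.of_forall fun ω => ?_)
  exact (Real.norm_of_nonneg (discountedPower_pos α σ r 1 B t.toNNReal ω).le).symm

/-- The expected total discounted value of a geometric Brownian motion. -/
lemma IsBrownianWrt.integral_integral_discountedPower [IsProbabilityMeasure P]
    {B : ℝ≥0 → Ω → ℝ} (hB : IsBrownianWrt B ℱ P) {α σ r : ℝ} (hr : α < r) :
    ∫ ω, (∫ t in Ioi (0 : ℝ), discountedPower α σ r 1 B t.toNNReal ω) ∂P = 1 / (r - α) := by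
  have hswap := integral_integral_swap
    (f := fun ω (t : ℝ) => discountedPower α σ r 1 B t.toNNReal ω)
    (hB.integrable_prod_discountedPower (σ := σ) hr)
  rw [hswap, setIntegral_congr_fun measurableSet_Ioi
    (fun t ht => hB.integral_discountedPower_one_toNNReal α σ r ht),
    integral_exp_mul_Ioi (sub_neg.2 hr) 0, mul_zero, Real.exp_zero, neg_div, ← div_neg, neg_sub]

end DiscountedPower

end IrreversibleInvestment

namespace IrreversibleInvestment

/-! ### Hitting times of a level -/

section HittingTime

open Classical in
/-- The first time at which the process `Z` reaches the level `l`. -/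
def hitTime {Ω : Type*} (Z : ℝ≥0 → Ω → ℝ) (l : ℝ) (ω : Ω) : WithTop ℝ≥0 :=
  if ∃ t, l ≤ Z t ω then ((sInf {t | l ≤ Z t ω} : ℝ≥0) : WithTop ℝ≥0) else ⊤

variable {Ω : Type*} {mΩ : MeasurableSpace Ω} {P : Measure Ω} {ℱ : Filtration ℝ≥0 mΩ}
  {Z : ℝ≥0 → Ω → ℝ} {l : ℝ} {ω : Ω}

lemma level_le_of_hitTime_eq (hc : Continuous (Z · ω)) {t : ℝ≥0} (h : hitTime Z l ω = t) :
    l ≤ Z t ω := by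
  unfold hitTime at h
  split_ifs at h with hex
  swap
  · exact absurd h (WithTop.top_ne_coe (a := t))
  rw [← WithTop.coe_inj.1 h]
  exact (isClosed_le continuous_const hc).csInf_mem hex (OrderBot.bddBelow _)

lemma hitTime_le_iff (hc : Continuous (Z · ω)) {t : ℝ≥0} :
    hitTime Z l ω ≤ t ↔ ∃ s ≤ t, l ≤ Z s ω := by
  constructor
  · intro h
    obtain ⟨s, hs⟩ := WithTop.ne_top_iff_exists.1 (h.trans_lt (WithTop.coe_lt_top t)).ne
    rw [← hs] at h
    exact ⟨s, WithTop.coe_le_coe.1 h, level_le_of_hitTime_eq hc hs.symm⟩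
  · rintro ⟨s, hst, hs⟩
    rw [hitTime, if_pos ⟨s, hs⟩]
    exact WithTop.coe_le_coe.2 
      ((csInf_le (OrderBot.bddBelow _) (show s ∈ {t | l ≤ Z t ω} from hs)).trans hst)

/-- Strictly before the hitting time the path is below `l`; the bound at `t` is a left limit, which
does not exist at `t = 0` and is replaced there by `h0`. -/
lemma le_level_of_le_hitTime (hc : Continuous (Z · ω)) (h0 : Z 0 ω ≤ l) {t : ℝ≥0}
    (ht : (t : WithTop ℝ≥0) ≤ hitTime Z l ω) : Z t ω ≤ l := by
  rcases eq_or_ne t 0 with rfl | hne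
  · exact h0
  · have hbot : (𝓝[<] t).NeBot := nhdsLT_neBot_of_exists_lt ⟨0, pos_of_ne_zero hne⟩
    refine le_of_tendsto (hc.continuousWithinAt (s := Iio t)) ?_
    filter_upwards [self_mem_nhdsWithin] with s hs
    by_contra! hcon
    have h1 : hitTime Z l ω ≤ s := (hitTime_le_iff hc).2 ⟨s, le_rfl, hcon.le⟩
    exact absurd (WithTop.coe_le_coe.1 (ht.trans h1)) (not_le.2 hs)

/-- Makes the hitting event a countable combination of events at times up to `t`. Density supplies
the approximating times, and the maximum over the compact interval recovers a time at which `l` is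
attained. -/
lemma exists_level_le_iff (hc : Continuous (Z · ω)) {t : ℝ≥0} :
    (∃ s ≤ t, l ≤ Z s ω) ↔
      ∀ n : ℕ, ∃ k : ℕ, l - 1 / ((n : ℝ) + 1) < Z (min (TopologicalSpace.denseSeq ℝ≥0 k) t) ω := by
  constructor
  · rintro ⟨s, hst, hs⟩ n
    have ho : IsOpen {q : ℝ≥0 | l - 1 / ((n : ℝ) + 1) < Z (min q t) ω} :=
      isOpen_lt continuous_const (hc.comp (continuous_id.min continuous_const))
    have hne : {q : ℝ≥0 | l - 1 / ((n : ℝ) + 1) < Z (min q t) ω}.Nonempty := by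
      refine ⟨s, ?_⟩
      have : (0 : ℝ) < 1 / ((n : ℝ) + 1) := by positivity
      change l - 1 / ((n : ℝ) + 1) < Z (min s t) ω
      rw [min_eq_left hst]
      linarith
    exact (TopologicalSpace.denseRange_denseSeq ℝ≥0).exists_mem_open ho hne
  · intro h
    obtain ⟨s, hs, hmax⟩ := (isCompact_Icc (a := (0 : ℝ≥0)) (b := t)).exists_isMaxOn
      ⟨0, by simp⟩ hc.continuousOn
    refine ⟨s, hs.2, ?_⟩
    have hlim : Tendsto (fun n : ℕ => l - 1 / ((n : ℝ) + 1)) atTop (𝓝 l) := by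
      simpa using tendsto_const_nhds.sub (tendsto_one_div_add_atTop_nhds_zero_nat (𝕜 := ℝ))
    refine le_of_tendsto' hlim fun n => ?_
    obtain ⟨k, hk⟩ := h n
    exact hk.le.trans (hmax ⟨zero_le, min_le_right _ _⟩)

/-- The hitting time of a level by an adapted process with almost surely continuous paths is a
stopping time, if the filtration contains the null sets. -/
lemma isStoppingTime_hitTime (hnull : ∀ t (s s' : Set Ω), s =ᵐ[P] s' → MeasurableSet[ℱ t] s' →
      MeasurableSet[ℱ t] s)
    (hZ : ∀ t, Measurable[ℱ t] (Z t)) (hc : ∀ᵐ ω ∂P, Continuous (Z · ω)) :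
    IsStoppingTime ℱ (hitTime Z l) := by
  intro t
  refine hnull t _ (⋂ n : ℕ, ⋃ k : ℕ,
    Z (min (TopologicalSpace.denseSeq ℝ≥0 k) t) ⁻¹' Ioi (l - 1 / ((n : ℝ) + 1))) ?_ ?_
  · refine eventuallyEq_set.2 ?_
    filter_upwards [hc] with ω hω
    rw [mem_iInter]
    simp only [mem_iUnion, mem_preimage, mem_Ioi]
    exact (hitTime_le_iff hω).trans (exists_level_le_iff hω)
  · exact MeasurableSet.iInter fun n => MeasurableSet.iUnion fun k =>
      ((hZ _).mono (ℱ.mono (min_le_right _ _)) le_rfl) measurableSet_Ioi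

end HittingTime

/-! ### The characteristic equation and Bernoulli's inequality -/

section CharacteristicRoot

lemma one_lt_of_isPositiveCharRoot {α σ r β : ℝ} (hr : 0 < r) (hα : α < r)
    (h : IsPositiveCharRoot α σ r β) : 1 < β := by
  obtain ⟨h0, h1⟩ := h
  by_contra! hle
  have e1 : 1 / 2 * σ ^ 2 * β * (β - 1) ≤ 0 :=
    mul_nonpos_of_nonneg_of_nonpos (by positivity) (by linarith)
  nlinarith

/-- The other root of the quadratic. -/
lemma exists_negative_charRoot {α σ r β : ℝ} (hσ : 0 < σ) (hr : 0 < r)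
    (h : IsPositiveCharRoot α σ r β) :
    ∃ γ < 0, 1 / 2 * σ ^ 2 * γ * (γ - 1) + α * γ - r = 0 := by
  obtain ⟨h0, h1⟩ := h
  -- By Vieta the product of the roots is `-2 * r / σ ^ 2`.
  refine ⟨-(2 * r / (σ ^ 2 * β)), by rw [neg_lt_zero]; positivity, ?_⟩
  have hα : α = (r - 1 / 2 * σ ^ 2 * β * (β - 1)) / β := by
    rw [eq_div_iff h0.ne']; linarith
  rw [hα]
  field_simp
  ring

/-- For these exponents `z ^ p` is convex on `z > 0`, so it lies above its tangent at `z = 1`; here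
`z = exp L`. -/
lemma one_add_mul_le_exp_mul {p : ℝ} (hp : p ≤ 0 ∨ 1 ≤ p) (L : ℝ) :
    1 + p * (Real.exp L - 1) ≤ Real.exp (p * L) := by
  rcases hp with hp | hp
  · have h1 := Real.add_one_le_exp L
    have h2 := Real.add_one_le_exp (p * L)
    nlinarith
  · have h := one_add_mul_self_le_rpow_one_add (s := Real.exp L - 1)
      (by linarith [Real.exp_pos L]) hp
    rwa [add_sub_cancel, ← Real.exp_mul, mul_comm L] at h

end CharacteristicRoot

/-! ### The one-product problem -/

section OneProduct

variable {Ω : Type*} {mΩ : MeasurableSpace Ω} {P : Measure Ω} [IsProbabilityMeasure P]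
  {ℱ : Filtration ℝ≥0 mΩ} {B : ℝ≥0 → Ω → ℝ} {α σ r β I w : ℝ}

/-- With one product, immediate investment is optimal above the threshold. -/
lemma integral_payoff_le_of_threshold_le (hB : IsBrownianWrt B ℱ P) (hσ : 0 < σ) (hr : 0 < r)
    (hα : α < r) (hI : 0 < I) (hβ : IsPositiveCharRoot α σ r β) (hw : β * I ≤ (β - 1) * w)
    {τ : Ω → WithTop ℝ≥0} (hτ : IsStoppingTime ℱ τ) :
    w * ∫ ω, valueAt (discountedPower α σ r 1 B) τ ω ∂P
      - I * ∫ ω, valueAt (discountedPower α σ r 0 B) τ ω ∂P ≤ w - I := by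
  have hβ1 := one_lt_of_isPositiveCharRoot hr hα hβ
  obtain ⟨γ, hγ, hγr⟩ := exists_negative_charRoot hσ hr hβ
  have hd : 0 < β - γ := by linarith
  have hwI : 0 ≤ w - I := by
    by_contra! hcon
    nlinarith
  obtain ⟨i₁, -⟩ := hB.integrable_and_integral_discountedPower_le (α := α) (σ := σ) (r := r)
    (p := 1) (by linarith) hτ
  obtain ⟨i₀, -⟩ := hB.integrable_and_integral_discountedPower_le (α := α) (σ := σ) (r := r)
    (p := 0) (by linarith) hτ
  obtain ⟨iβ, hβ'⟩ := hB.integrable_and_integral_discountedPower_le hβ.2.le hτ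
  obtain ⟨iγ, hγ'⟩ := hB.integrable_and_integral_discountedPower_le hγr.le hτ
  -- The weights make `c * z ^ β + d * z ^ γ` agree with `w * z - I` in value and slope at `z = 1`.
  -- The threshold condition `hw` is precisely `0 ≤ d`.
  set c := (w - γ * (w - I)) / (β - γ) with hc
  set d := (β * (w - I) - w) / (β - γ) with hd'
  have hc0 : 0 ≤ c := div_nonneg (by nlinarith) hd.le
  have hd0 : 0 ≤ d := div_nonneg (by nlinarith) hd.le
  have hcd : c + d = w - I := by rw [hc, hd']; field_simp; ring
  have hcd' : c * β + d * γ = w := by rw [hc, hd']; field_simp; ring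
  have hpt : ∀ t ω, w * discountedPower α σ r 1 B t ω - I * discountedPower α σ r 0 B t ω ≤
      c * discountedPower α σ r β B t ω + d * discountedPower α σ r γ B t ω := fun t ω => by
    simp only [discountedPower, sub_eq_add_neg _ (r * (t : ℝ)), Real.exp_add, one_mul, zero_mul,
      Real.exp_zero]
    set L := logPrice α σ B t ω
    have h1 := mul_le_mul_of_nonneg_left (one_add_mul_le_exp_mul (.inr hβ1.le) L) hc0
    have h2 := mul_le_mul_of_nonneg_left (one_add_mul_le_exp_mul (.inl hγ.le) L) hd0
    have h3 : w * Real.exp L - I ≤ c * Real.exp (β * L) + d * Real.exp (γ * L) := by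
      have : w * Real.exp L - I = c * (1 + β * (Real.exp L - 1)) +
        d * (1 + γ * (Real.exp L - 1)) := by linear_combination (-hcd) - (Real.exp L - 1) * hcd'
      linarith
    have := mul_le_mul_of_nonneg_right h3 (Real.exp_pos (-(r * t))).le
    linarith
  calc w * ∫ ω, valueAt (discountedPower α σ r 1 B) τ ω ∂P
        - I * ∫ ω, valueAt (discountedPower α σ r 0 B) τ ω ∂P
      = ∫ ω, (w * valueAt (discountedPower α σ r 1 B) τ ω
        - I * valueAt (discountedPower α σ r 0 B) τ ω) ∂P := by
        rw [integral_sub (i₁.const_mul _) (i₀.const_mul _), integral_const_mul,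
          integral_const_mul]
    _ ≤ ∫ ω, (c * valueAt (discountedPower α σ r β B) τ ω
        + d * valueAt (discountedPower α σ r γ B) τ ω) ∂P := by
        refine integral_mono ((i₁.const_mul _).sub (i₀.const_mul _))
          ((iβ.const_mul _).add (iγ.const_mul _)) fun ω => ?_
        cases h : τ ω with
        | top => simp [valueAt_of_eq_top h]
        | coe t => simpa only [valueAt_of_eq_coe h] using hpt t ω
    _ = c * ∫ ω, valueAt (discountedPower α σ r β B) τ ω ∂P
        + d * ∫ ω, valueAt (discountedPower α σ r γ B) τ ω ∂P := by
        rw [integral_add (iβ.const_mul _) (iγ.const_mul _), integral_const_mul,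
          integral_const_mul]
    _ ≤ c * 1 + d * 1 := by gcongr
    _ = w - I := by rw [mul_one, mul_one, hcd]

/-- The Laplace transform of the hitting time of a level. -/
lemma exp_neg_le_integral_hitTime (hB : IsBrownianWrt B ℱ P) (hr : 0 < r)
    (hβ : IsPositiveCharRoot α σ r β) {l : ℝ} (hl : 0 ≤ l)
    (hτ : IsStoppingTime ℱ (hitTime (logPrice α σ B) l)) :
    Real.exp (-(β * l)) ≤
      ∫ ω, valueAt (discountedPower α σ r 0 B) (hitTime (logPrice α σ B) l) ω ∂P := by
  set τ := hitTime (logPrice α σ B) l with hτdef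
  obtain ⟨i₀, -⟩ := hB.integrable_and_integral_discountedPower_le (α := α) (σ := σ) (r := r)
    (p := 0) (by linarith) hτ
  -- Optional stopping of the `β`-martingale at `min τ T`. Up to that time the log price is at most
  -- `l`; the event that `l` is not reached by `T` contributes at most the last term, which vanishes
  -- as `T` grows.
  have key : ∀ T : ℕ, 1 ≤ Real.exp (β * l) * ∫ ω, valueAt (discountedPower α σ r 0 B) τ ω ∂P
      + Real.exp (β * l - r * T) := fun T => by
    obtain ⟨h1, h2⟩ := hB.integral_discountedPower_eq_one hβ.2 (isStoppingTime_cutoff hτ T)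
      (cutoff_le τ T)
    have hle : ∀ᵐ ω ∂P, discountedPower α σ r β B (cutoff τ T ω) ω ≤
        Real.exp (β * l) * valueAt (discountedPower α σ r 0 B) τ ω + Real.exp (β * l - r * T) := by
      filter_upwards [hB.isBrownian.cont, hB.isBrownian.eval_zero_ae_eq_zero] with ω hω hω0
      have hcont : Continuous (logPrice α σ B · ω) := by unfold logPrice; fun_prop
      have hle0 : logPrice α σ B 0 ω ≤ l := by simpa [logPrice, hω0] using hl
      have hlev : logPrice α σ B (cutoff τ T ω) ω ≤ l := by
        refine le_level_of_le_hitTime hcont hle0 ?_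
        rw [coe_cutoff]
        exact min_le_left _ _
      have hmul := mul_le_mul_of_nonneg_left hlev hβ.1.le
      by_cases hT : τ ω ≤ ((T : ℝ≥0) : WithTop ℝ≥0)
      · obtain ⟨t, ht⟩ := WithTop.ne_top_iff_exists.1 (hT.trans_lt (WithTop.coe_lt_top _)).ne
        rw [← ht] at hT
        rw [cutoff_of_le ht.symm (WithTop.coe_le_coe.1 hT)] at hmul ⊢
        rw [valueAt_of_eq_coe ht.symm, discountedPower, discountedPower, ← Real.exp_add]
        refine le_add_of_le_of_nonneg (Real.exp_le_exp.2 ?_) (Real.exp_pos _).le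
        linarith
      · rw [cutoff_of_not_le hT] at hmul ⊢
        refine le_add_of_nonneg_of_le (mul_nonneg (Real.exp_pos _).le ?_) (Real.exp_le_exp.2 ?_)
        · cases h : τ ω with
          | top => rw [valueAt_of_eq_top h]
          | coe t => rw [valueAt_of_eq_coe h]; exact (discountedPower_pos _ _ _ _ _ _ _).le
        · simpa using hmul
    calc 1 = ∫ ω, discountedPower α σ r β B (cutoff τ T ω) ω ∂P := h2.symm
      _ ≤ ∫ ω, (Real.exp (β * l) * valueAt (discountedPower α σ r 0 B) τ ω
          + Real.exp (β * l - r * T)) ∂P :=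
          integral_mono_ae h1 ((i₀.const_mul _).add (integrable_const _)) hle
      _ = _ := by
          rw [integral_add (i₀.const_mul _) (integrable_const _), integral_const_mul]
          simp
  have hlim : Tendsto (fun T : ℕ => Real.exp (β * l) *
      ∫ ω, valueAt (discountedPower α σ r 0 B) τ ω ∂P + Real.exp (β * l - r * T)) atTop
      (𝓝 (Real.exp (β * l) * ∫ ω, valueAt (discountedPower α σ r 0 B) τ ω ∂P + 0)) := by
    refine tendsto_const_nhds.add (Real.tendsto_exp_atBot.comp ?_)
    exact tendsto_atBot_add_const_left _ _ (tendsto_neg_atTop_atBot.comp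
      (tendsto_natCast_atTop_atTop.const_mul_atTop hr))
  have h1 := ge_of_tendsto' hlim key
  rw [add_zero] at h1
  have h2 := mul_le_mul_of_nonneg_left h1 (Real.exp_pos (-(β * l))).le
  rwa [mul_one, ← mul_assoc, ← Real.exp_add, neg_add_cancel, Real.exp_zero, one_mul] at h2

/-- With one product, immediate investment is not optimal below the threshold. -/
lemma exists_integral_payoff_gt_of_lt_threshold (hB : IsBrownianWrt B ℱ P)
    (hnull : ∀ t (s s' : Set Ω), s =ᵐ[P] s' → MeasurableSet[ℱ t] s' → MeasurableSet[ℱ t] s)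
    (hr : 0 < r) (hα : α < r) (hI : 0 < I) (hβ : IsPositiveCharRoot α σ r β)
    (hw0 : 0 ≤ w) (hw : (β - 1) * w < β * I) :
    ∃ τ : Ω → WithTop ℝ≥0, IsStoppingTime ℱ τ ∧
      w - I < w * ∫ ω, valueAt (discountedPower α σ r 1 B) τ ω ∂P
        - I * ∫ ω, valueAt (discountedPower α σ r 0 B) τ ω ∂P := by
  have hβ1 := one_lt_of_isPositiveCharRoot hr hα hβ
  rcases hw0.eq_or_lt with rfl | hwpos
  -- A worthless project: never investing yields `0`, more than `-I`.
  · refine ⟨fun _ => ⊤, fun t => by simp, ?_⟩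
    simp [valueAt, hI]
  have hb : 0 < β - 1 := by linarith
  -- The threshold in terms of project value; from `w` it is reached when the log price hits `log (v
  -- / w)`.
  set v := β * I / (β - 1) with hv
  have hv' : (β - 1) * v = β * I := by rw [hv]; field_simp
  have hwv : w < v := by
    rw [hv, lt_div_iff₀ hb]; linarith
  have hvpos : 0 < v := hwpos.trans hwv
  have hvI : (β - 1) * (v - I) = I := by linarith
  have hvI0 : 0 < v - I := by
    by_contra! hcon
    nlinarith
  set l := Real.log (v / w) with hl
  have hlpos : 0 < l := Real.log_pos (by rwa [one_lt_div hwpos])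
  have hexpl : w * Real.exp l = v := by
    rw [hl, Real.exp_log (by positivity)]; field_simp
  have hZc : ∀ᵐ ω ∂P, Continuous (logPrice α σ B · ω) := by
    filter_upwards [hB.isBrownian.cont] with ω hω
    unfold logPrice
    fun_prop
  have hτ : IsStoppingTime ℱ (hitTime (logPrice α σ B) l) :=
    isStoppingTime_hitTime hnull (fun t => ((hB.adapted t).const_mul σ).const_add _) hZc
  refine ⟨_, hτ, ?_⟩
  have hlap := exp_neg_le_integral_hitTime hB hr hβ hlpos.le hτ
  set τ := hitTime (logPrice α σ B) l with hτdef
  obtain ⟨i₁, -⟩ := hB.integrable_and_integral_discountedPower_le (α := α) (σ := σ) (r := r)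
    (p := 1) (by linarith) hτ
  obtain ⟨i₀, -⟩ := hB.integrable_and_integral_discountedPower_le (α := α) (σ := σ) (r := r)
    (p := 0) (by linarith) hτ
  have hA : Real.exp l * ∫ ω, valueAt (discountedPower α σ r 0 B) τ ω ∂P ≤
      ∫ ω, valueAt (discountedPower α σ r 1 B) τ ω ∂P := by
    rw [← integral_const_mul]
    refine integral_mono_ae (i₀.const_mul _) i₁ ?_
    filter_upwards [hZc] with ω hω
    cases h : τ ω with
    | top => simp [valueAt_of_eq_top h]
    | coe t =>
      have := level_le_of_hitTime_eq hω h
      rw [valueAt_of_eq_coe h, valueAt_of_eq_coe h, discountedPower, discountedPower,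
        ← Real.exp_add]
      refine Real.exp_le_exp.2 ?_
      linarith
  -- As a function of `w` the right side is `(v - I) * (w / v) ^ β`, strictly convex, and `w - I` is
  -- its tangent at `w = v` because `β * (v - I) = v`.
  have hbern : w - I < (v - I) * Real.exp (-(β * l)) := by
    have hu : Real.exp (-l) = w / v := by
      rw [Real.exp_neg, ← hexpl]
      field_simp
    have h := one_add_mul_self_lt_rpow_one_add (s := Real.exp (-l) - 1)
      (by linarith [Real.exp_pos (-l)])
      (by
        have : Real.exp (-l) < 1 := by rw [← Real.exp_zero]; exact Real.exp_lt_exp.2 (by linarith)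
        linarith) hβ1
    rw [add_sub_cancel, ← Real.exp_mul, hu] at h
    have h1 := mul_lt_mul_of_pos_left h hvI0
    have h2 : (v - I) * (1 + β * (w / v - 1)) = w - I := by
      have : β * (v - I) = v := by linarith
      have h3 : β * (v - I) * (w / v) = w := by rw [this]; field_simp
      linarith
    rw [h2] at h1
    rwa [neg_mul, mul_comm l] at h1
  have h1 := mul_le_mul_of_nonneg_left hA hwpos.le
  rw [← mul_assoc, hexpl] at h1
  have h2 := mul_le_mul_of_nonneg_left hlap hvI0.le
  linarith

end OneProduct

end IrreversibleInvestment

namespace IrreversibleInvestment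

/-! ### Boundaries of closed convex upper sets in the quadrant -/

section ConvexUpperSet

variable {S : Set (ℝ × ℝ)} {X Y : ℝ}

/-- The lower boundary `x ↦ sup {y ≥ 0 : (x, y) ∉ S}` of a subset of the quadrant. -/
def lowerBoundary (S : Set (ℝ × ℝ)) (x : ℝ) : ℝ := sSup {y | 0 ≤ y ∧ (x, y) ∉ S}

lemma lowerBoundary_nonneg (S : Set (ℝ × ℝ)) (x : ℝ) : 0 ≤ lowerBoundary S x :=
  Real.sSup_nonneg fun _ hy => hy.1

/-- A closed convex subset of the quadrant that contains, with each of its points, all larger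
ones, and that meets both axes. -/
structure IsConvexUpperSet (S : Set (ℝ × ℝ)) (X Y : ℝ) : Prop where
  nonneg : ∀ p ∈ S, 0 ≤ p.1 ∧ 0 ≤ p.2
  convex : Convex ℝ S
  isClosed : IsClosed S
  mono : ∀ x y x' y', (x, y) ∈ S → x ≤ x' → y ≤ y' → (x', y') ∈ S
  left_mem : (X, 0) ∈ S
  right_mem_iff : ∀ y, 0 ≤ y → ((0, y) ∈ S ↔ Y ≤ y)
  left_pos : 0 < X
  right_pos : 0 < Y

namespace IsConvexUpperSet

lemma bddAbove (h : IsConvexUpperSet S X Y) {x : ℝ} (hx : 0 ≤ x) :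
    BddAbove {y | 0 ≤ y ∧ (x, y) ∉ S} := by
  refine ⟨Y, fun y hy => ?_⟩
  by_contra! hcon
  exact hy.2 (h.mono 0 y x y ((h.right_mem_iff y hy.1).2 hcon.le) hx le_rfl)

/-- Points strictly above the boundary lie in `S` by definition of the supremum; closedness adds the
boundary itself. -/
lemma mem_iff (h : IsConvexUpperSet S X Y) {x y : ℝ} :
    (x, y) ∈ S ↔ 0 ≤ x ∧ 0 ≤ y ∧ lowerBoundary S x ≤ y := by
  constructor
  · intro hS
    obtain ⟨hx, hy⟩ := h.nonneg _ hS
    refine ⟨hx, hy, Real.sSup_le (fun y' hy' => ?_) hy⟩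
    by_contra! hcon
    exact hy'.2 (h.mono x y x y' hS le_rfl hcon.le)
  · rintro ⟨hx, hy, hb⟩
    have hlim : Tendsto (fun n : ℕ => (x, y + 1 / ((n : ℝ) + 1))) atTop (𝓝 (x, y)) := by
      refine tendsto_const_nhds.prodMk_nhds ?_
      simpa using tendsto_const_nhds.add (tendsto_one_div_add_atTop_nhds_zero_nat (𝕜 := ℝ))
    refine h.isClosed.mem_of_tendsto hlim (.of_forall fun n => ?_)
    have hn : (0 : ℝ) < 1 / ((n : ℝ) + 1) := by positivity
    by_contra hcon
    have := le_csSup (h.bddAbove hx) (⟨by linarith, hcon⟩ :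
      y + 1 / ((n : ℝ) + 1) ∈ {y | 0 ≤ y ∧ (x, y) ∉ S})
    rw [← lowerBoundary] at this
    linarith

lemma graph_mem (h : IsConvexUpperSet S X Y) {x : ℝ} (hx : 0 ≤ x) :
    (x, lowerBoundary S x) ∈ S :=
  h.mem_iff.2 ⟨hx, lowerBoundary_nonneg S x, le_rfl⟩

lemma convexOn (h : IsConvexUpperSet S X Y) : ConvexOn ℝ (Ici 0) (lowerBoundary S) := by
  refine ⟨convex_Ici 0, fun x hx z hz s t hs ht hst => ?_⟩
  have := h.convex (h.graph_mem hx) (h.graph_mem hz) hs ht hst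
  exact (h.mem_iff.1 this).2.2

lemma apply_zero (h : IsConvexUpperSet S X Y) : lowerBoundary S 0 = Y :=
  le_antisymm (h.mem_iff.1 ((h.right_mem_iff Y h.right_pos.le).2 le_rfl)).2.2
    ((h.right_mem_iff _ (lowerBoundary_nonneg S 0)).1 (h.graph_mem le_rfl))

lemma eq_zero (h : IsConvexUpperSet S X Y) {x : ℝ} (hx : X ≤ x) : lowerBoundary S x = 0 :=
  le_antisymm (h.mem_iff.1 (h.mono X 0 x 0 h.left_mem hx le_rfl)).2.2 (lowerBoundary_nonneg S x)

lemma le_right (h : IsConvexUpperSet S X Y) {x : ℝ} (hx : 0 ≤ x) : lowerBoundary S x ≤ Y :=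
  (h.mem_iff.1 (h.mono 0 Y x Y ((h.right_mem_iff Y h.right_pos.le).2 le_rfl) hx le_rfl)).2.2

/-- The graph lies below the chord from `(0, Y)` to `(x + X, 0)`. The endpoint `x + X` keeps `x`
strictly inside for every `x > 0`. -/
lemma lt_right (h : IsConvexUpperSet S X Y) {x : ℝ} (hx : 0 < x) : lowerBoundary S x < Y := by
  have hX := h.left_pos
  have hs : 0 < x + X := by linarith
  have hc := h.convexOn.2 (x := 0) self_mem_Ici (mem_Ici.2 hs.le)
    (show 0 ≤ X / (x + X) by positivity) (show 0 ≤ x / (x + X) by positivity)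
    (by rw [← add_div, add_comm X, div_self hs.ne'])
  rw [h.apply_zero, h.eq_zero (by linarith : X ≤ x + X)] at hc
  have e : (X / (x + X)) • (0 : ℝ) + (x / (x + X)) • (x + X) = x := by
    simp only [smul_eq_mul]; field_simp; simp
  rw [e] at hc
  refine hc.trans_lt ?_
  have : X / (x + X) < 1 := by rw [div_lt_one hs]; linarith
  simp only [smul_eq_mul, mul_zero, add_zero]
  nlinarith [h.right_pos]

/-- Convexity gives continuity only in the interior. At `0` the upper estimate is the global bound
`Y`, and the lower one holds because the complement of `S` is open. -/
lemma continuousOn (h : IsConvexUpperSet S X Y) : ContinuousOn (lowerBoundary S) (Ici 0) := by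
  intro x hx
  rcases (mem_Ici.1 hx).eq_or_lt with rfl | hpos
  · rw [ContinuousWithinAt, h.apply_zero, tendsto_order]
    constructor
    · intro y hy
      rcases lt_or_ge y 0 with hy0 | hy0
      · exact .of_forall fun x => hy0.trans_le (lowerBoundary_nonneg S x)
      · have hn : ((0 : ℝ), y) ∈ Sᶜ := fun hmem => hy.not_ge ((h.right_mem_iff y hy0).1 hmem)
        have hcont : Tendsto (fun x : ℝ => (x, y)) (𝓝[Ici 0] 0) (𝓝 (0, y)) :=
          ((continuous_id.prodMk continuous_const).tendsto 0).mono_left nhdsWithin_le_nhds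
        filter_upwards [hcont.eventually (h.isClosed.isOpen_compl.mem_nhds hn),
          self_mem_nhdsWithin] with x hxS hx0
        by_contra! hcon
        exact hxS (h.mem_iff.2 ⟨hx0, hy0, hcon⟩)
    · intro y hy
      filter_upwards [self_mem_nhdsWithin] with x hx0 using (h.le_right hx0).trans_lt hy
  · have := h.convexOn.continuousOn_interior
    rw [interior_Ici] at this
    exact (this.continuousAt (Ioi_mem_nhds hpos)).continuousWithinAt

end IsConvexUpperSet

end ConvexUpperSet

/-! ### The threshold in terms of project value -/

section Threshold

lemma threshold_le_iff {α r Q I β z : ℝ} (hα : α < r) (hQ : 0 < Q) (hβ : 1 < β) :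
    threshold α r Q I β ≤ z ↔ β * I ≤ (β - 1) * (Q * z / (r - α)) := by
  have h1 : 0 < r - α := sub_pos.2 hα
  have h2 : 0 < β - 1 := sub_pos.2 hβ
  have e1 : threshold α r Q I β = β * I * ((r - α) / ((β - 1) * Q)) := by
    rw [threshold]; ring
  have e2 : (β - 1) * (Q * z / (r - α)) = z / ((r - α) / ((β - 1) * Q)) := by
    field_simp
  rw [e1, e2, le_div_iff₀ (by positivity)]

lemma threshold_pos {α r Q I β : ℝ} (hα : α < r) (hQ : 0 < Q) (hI : 0 < I) (hβ : 1 < β) :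
    0 < threshold α r Q I β := by
  have h1 : 0 < r - α := sub_pos.2 hα
  have h2 : 0 < β - 1 := sub_pos.2 hβ
  rw [threshold]
  positivity

end Threshold

/-! ### The two-product model -/

section Model

lemma discountedPower_zero {Ω : Type*} (α σ α' σ' r : ℝ) (B B' : ℝ≥0 → Ω → ℝ) :
    discountedPower α σ r 0 B = discountedPower α' σ' r 0 B' := by
  ext t ω
  simp [discountedPower]

variable {Ω : Type*} [MeasurableSpace Ω] {P : Measure Ω}

/-- Needed for hitting times, since paths are continuous only almost surely. -/
lemma brownianFiltration_congr [P.IsComplete] {W : PlanarBrownianMotion P} (t : ℝ≥0)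
    (s s' : Set Ω) (h : s =ᵐ[P] s') (hs : MeasurableSet[brownianFiltration W t] s') :
    MeasurableSet[brownianFiltration W t] s := by
  obtain ⟨u, hu, hu'⟩ := hs
  exact ⟨u, hu, h.trans hu'⟩

lemma discountedRevenue_eq (W : PlanarBrownianMotion P) (θ : Params) (x y t : ℝ) (ht : 0 < t)
    (ω : Ω) :
    discountedRevenue W θ x y t ω =
      θ.Q₁ * x * discountedPower θ.α₁ θ.σ₁ θ.r 1 W.WX t.toNNReal ω
        + θ.Q₂ * y * discountedPower θ.α₂ θ.σ₂ θ.r 1 W.WY t.toNNReal ω := by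
  simp only [discountedRevenue, profit, priceX, priceY, geomBrownian, discountedPower, logPrice,
    sub_eq_add_neg _ (θ.r * _), Real.exp_add _ (-(θ.r * _)), one_mul,
    Real.coe_toNNReal t ht.le, neg_mul]
  ring

/-- The expected discounted price `𝔼[e^{-rτ} X_τ]` of the first product, for `X_0 = 1`. -/
def meanX (W : PlanarBrownianMotion P) (θ : Params) (τ : Ω → WithTop ℝ≥0) : ℝ :=
  ∫ ω, valueAt (discountedPower θ.α₁ θ.σ₁ θ.r 1 W.WX) τ ω ∂P

/-- The expected discounted price `𝔼[e^{-rτ} Y_τ]` of the second product, for `Y_0 = 1`. -/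
def meanY (W : PlanarBrownianMotion P) (θ : Params) (τ : Ω → WithTop ℝ≥0) : ℝ :=
  ∫ ω, valueAt (discountedPower θ.α₂ θ.σ₂ θ.r 1 W.WY) τ ω ∂P

/-- The expected discount factor `𝔼[e^{-rτ}]`. -/
def meanDiscount (W : PlanarBrownianMotion P) (θ : Params) (τ : Ω → WithTop ℝ≥0) : ℝ :=
  ∫ ω, valueAt (discountedPower θ.α₁ θ.σ₁ θ.r 0 W.WX) τ ω ∂P

lemma meanDiscount_nonneg (W : PlanarBrownianMotion P) (θ : Params) (τ : Ω → WithTop ℝ≥0) :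
    0 ≤ meanDiscount W θ τ := by
  refine integral_nonneg fun ω => ?_
  cases h : τ ω with
  | top => rw [valueAt_of_eq_top h, Pi.zero_apply]
  | coe t => rw [valueAt_of_eq_coe h]; exact (discountedPower_pos _ _ _ _ _ _ _).le

variable [IsProbabilityMeasure P] [P.IsComplete] (W : PlanarBrownianMotion P) {θ : Params}

lemma integrable_discountedRevenue (h₁ : θ.α₁ < θ.r) (h₂ : θ.α₂ < θ.r) (x y : ℝ) :
    Integrable (fun p : Ω × ℝ => discountedRevenue W θ x y p.2 p.1)
      (P.prod (volume.restrict (Ioi (0 : ℝ)))) := by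
  have hX := (isBrownianWrt_WX W).integrable_prod_discountedPower (σ := θ.σ₁) h₁
  have hY := (isBrownianWrt_WY W).integrable_prod_discountedPower (σ := θ.σ₂) h₂
  refine ((hX.const_mul (θ.Q₁ * x)).add (hY.const_mul (θ.Q₂ * y))).congr ?_
  have hpos : ∀ᵐ t ∂volume.restrict (Ioi (0 : ℝ)), 0 < t := ae_restrict_mem measurableSet_Ioi
  filter_upwards [Measure.quasiMeasurePreserving_snd.ae hpos] with q hq
  exact (discountedRevenue_eq W θ x y q.2 hq q.1).symm

/-- The net present value of an immediate investment. -/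
lemma F_eq (h₁ : θ.α₁ < θ.r) (h₂ : θ.α₂ < θ.r) (x y : ℝ) :
    F W θ x y = θ.Q₁ * x / (θ.r - θ.α₁) + θ.Q₂ * y / (θ.r - θ.α₂) - θ.I := by
  have hX := (isBrownianWrt_WX W).integrable_prod_discountedPower (σ := θ.σ₁) h₁
  have hY := (isBrownianWrt_WY W).integrable_prod_discountedPower (σ := θ.σ₂) h₂
  have hin : (fun ω => ∫ t in Ioi (0 : ℝ), discountedRevenue W θ x y t ω) =ᵐ[P] fun ω =>
      θ.Q₁ * x * (∫ t in Ioi (0 : ℝ), discountedPower θ.α₁ θ.σ₁ θ.r 1 W.WX t.toNNReal ω)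
      + θ.Q₂ * y * ∫ t in Ioi (0 : ℝ), discountedPower θ.α₂ θ.σ₂ θ.r 1 W.WY t.toNNReal ω := by
    filter_upwards [hX.prod_right_ae, hY.prod_right_ae] with ω h1 h2
    rw [setIntegral_congr_fun measurableSet_Ioi fun t ht => discountedRevenue_eq W θ x y t ht ω,
      integral_add (h1.const_mul _) (h2.const_mul _), integral_const_mul, integral_const_mul]
  have hint := (integrable_discountedRevenue W h₁ h₂ x y).integral_prod_left
  rw [F, integral_sub hint (integrable_const _), integral_congr_ae hin,
    integral_add (hX.integral_prod_left.const_mul _) (hY.integral_prod_left.const_mul _),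
    integral_const_mul, integral_const_mul,
    (isBrownianWrt_WX W).integral_integral_discountedPower h₁,
    (isBrownianWrt_WY W).integral_integral_discountedPower h₂]
  simp
  ring

lemma stoppedPayoff_eq (h₁ : θ.α₁ < θ.r) (h₂ : θ.α₂ < θ.r) (x y : ℝ) (τ : Ω → WithTop ℝ≥0)
    (ω : Ω) :
    stoppedPayoff W θ x y τ ω =
      θ.Q₁ * x / (θ.r - θ.α₁) * valueAt (discountedPower θ.α₁ θ.σ₁ θ.r 1 W.WX) τ ω
      + θ.Q₂ * y / (θ.r - θ.α₂) * valueAt (discountedPower θ.α₂ θ.σ₂ θ.r 1 W.WY) τ ω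
      - θ.I * valueAt (discountedPower θ.α₁ θ.σ₁ θ.r 0 W.WX) τ ω := by
  cases h : τ ω with
  | top => simp [valueAt_of_eq_top h, stoppedPayoff, h]
  | coe t =>
    simp only [valueAt_of_eq_coe h, stoppedPayoff, h, F_eq W h₁ h₂, priceX, priceY, geomBrownian,
      discountedPower, logPrice, sub_eq_add_neg _ (θ.r * _), Real.exp_add _ (-(θ.r * _)), one_mul,
      zero_mul, Real.exp_zero, neg_mul]
    ring

variable {W} {τ : Ω → WithTop ℝ≥0}

lemma integrable_meanX (h₁ : θ.α₁ < θ.r) (hτ : IsStoppingTime (brownianFiltration W) τ) :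
    Integrable (valueAt (discountedPower θ.α₁ θ.σ₁ θ.r 1 W.WX) τ) P ∧ meanX W θ τ ≤ 1 :=
  (isBrownianWrt_WX W).integrable_and_integral_discountedPower_le (by linarith) hτ

lemma integrable_meanY (h₂ : θ.α₂ < θ.r) (hτ : IsStoppingTime (brownianFiltration W) τ) :
    Integrable (valueAt (discountedPower θ.α₂ θ.σ₂ θ.r 1 W.WY) τ) P ∧ meanY W θ τ ≤ 1 :=
  (isBrownianWrt_WY W).integrable_and_integral_discountedPower_le (by linarith) hτ

lemma integrable_meanDiscount (hr : 0 < θ.r) (hτ : IsStoppingTime (brownianFiltration W) τ) :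
    Integrable (valueAt (discountedPower θ.α₁ θ.σ₁ θ.r 0 W.WX) τ) P ∧ meanDiscount W θ τ ≤ 1 :=
  (isBrownianWrt_WX W).integrable_and_integral_discountedPower_le (by linarith) hτ

lemma integrable_stoppedPayoff (hr : 0 < θ.r) (h₁ : θ.α₁ < θ.r) (h₂ : θ.α₂ < θ.r) (x y : ℝ)
    (hτ : IsStoppingTime (brownianFiltration W) τ) :
    Integrable (stoppedPayoff W θ x y τ) P := by
  rw [funext (stoppedPayoff_eq W h₁ h₂ x y τ)]
  exact (((integrable_meanX h₁ hτ).1.const_mul _).add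
    ((integrable_meanY h₂ hτ).1.const_mul _)).sub ((integrable_meanDiscount hr hτ).1.const_mul _)

lemma J_eq (hr : 0 < θ.r) (h₁ : θ.α₁ < θ.r) (h₂ : θ.α₂ < θ.r) (x y : ℝ)
    (hτ : IsStoppingTime (brownianFiltration W) τ) :
    J W θ x y τ = θ.Q₁ * x / (θ.r - θ.α₁) * meanX W θ τ
      + θ.Q₂ * y / (θ.r - θ.α₂) * meanY W θ τ - θ.I * meanDiscount W θ τ := by
  have iX := (integrable_meanX h₁ hτ).1.const_mul (θ.Q₁ * x / (θ.r - θ.α₁))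
  have iY := (integrable_meanY h₂ hτ).1.const_mul (θ.Q₂ * y / (θ.r - θ.α₂))
  have iD := (integrable_meanDiscount hr hτ).1.const_mul θ.I
  have iXY : Integrable (fun ω =>
      θ.Q₁ * x / (θ.r - θ.α₁) * valueAt (discountedPower θ.α₁ θ.σ₁ θ.r 1 W.WX) τ ω
      + θ.Q₂ * y / (θ.r - θ.α₂) * valueAt (discountedPower θ.α₂ θ.σ₂ θ.r 1 W.WY) τ ω) P :=
    iX.add iY
  rw [J, integral_congr_ae (.of_forall (stoppedPayoff_eq W h₁ h₂ x y τ)),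
    integral_sub iXY iD, integral_add iX iY, integral_const_mul, integral_const_mul,
    integral_const_mul, meanX, meanY, meanDiscount]

lemma bddAbove_attainableValues (hr : 0 < θ.r) (h₁ : θ.α₁ < θ.r) (h₂ : θ.α₂ < θ.r)
    (hQ₁ : 0 < θ.Q₁) (hQ₂ : 0 < θ.Q₂) (hI : 0 < θ.I) {x y : ℝ} (hx : 0 ≤ x) (hy : 0 ≤ y) :
    BddAbove (attainableValues W θ x y) := by
  refine ⟨θ.Q₁ * x / (θ.r - θ.α₁) + θ.Q₂ * y / (θ.r - θ.α₂), ?_⟩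
  rintro _ ⟨τ, hτ, rfl⟩
  rw [J_eq hr h₁ h₂ x y hτ]
  have h1 := mul_le_of_le_one_right (div_nonneg (mul_nonneg hQ₁.le hx) (sub_pos.2 h₁).le)
    (integrable_meanX h₁ hτ).2
  have h2 := mul_le_of_le_one_right (div_nonneg (mul_nonneg hQ₂.le hy) (sub_pos.2 h₂).le)
    (integrable_meanY h₂ hτ).2
  have h3 := mul_nonneg hI.le (meanDiscount_nonneg W θ τ)
  linarith

/-- Stopping at time `0`, where both motions vanish almost surely. -/
lemma F_mem_attainableValues (W : PlanarBrownianMotion P) (θ : Params) (x y : ℝ) :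
    F W θ x y ∈ attainableValues W θ x y := by
  refine ⟨fun _ => (0 : ℝ≥0), isStoppingTime_const _ 0, ?_⟩
  have : stoppedPayoff W θ x y (fun _ => ((0 : ℝ≥0) : WithTop ℝ≥0)) =ᵐ[P]
      fun _ => F W θ x y := by
    filter_upwards [W.isBrownian_WX.eval_zero_ae_eq_zero,
      W.isBrownian_WY.eval_zero_ae_eq_zero] with ω hX hY
    simp [stoppedPayoff, priceX, priceY, geomBrownian, hX, hY]
  rw [J, integral_congr_ae this]
  simp

lemma F_lt_V_iff {x y : ℝ} (hbdd : BddAbove (attainableValues W θ x y)) :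
    F W θ x y < V W θ x y ↔
      ∃ τ, IsStoppingTime (brownianFiltration W) τ ∧ F W θ x y < J W θ x y τ := by
  rw [V, lt_csSup_iff hbdd ⟨_, F_mem_attainableValues W θ x y⟩]
  constructor
  · rintro ⟨_, ⟨τ, hτ, rfl⟩, h⟩
    exact ⟨τ, hτ, h⟩
  · rintro ⟨τ, hτ, h⟩
    exact ⟨_, ⟨τ, hτ, rfl⟩, h⟩

lemma V_eq_F_iff {x y : ℝ} (hbdd : BddAbove (attainableValues W θ x y)) :
    V W θ x y = F W θ x y ↔
      ∀ τ, IsStoppingTime (brownianFiltration W) τ → J W θ x y τ ≤ F W θ x y := by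
  have hle : F W θ x y ≤ V W θ x y := le_csSup hbdd (F_mem_attainableValues W θ x y)
  have h := not_congr (F_lt_V_iff hbdd)
  push Not at h
  exact ⟨fun e => h.1 e.le, fun e => le_antisymm (h.2 e) hle⟩

/-- The stopping region is an intersection of closed half planes with the quadrant. -/
lemma mem_stoppingRegion_iff (hr : 0 < θ.r) (h₁ : θ.α₁ < θ.r) (h₂ : θ.α₂ < θ.r)
    (hQ₁ : 0 < θ.Q₁) (hQ₂ : 0 < θ.Q₂) (hI : 0 < θ.I) {x y : ℝ} :
    (x, y) ∈ stoppingRegion W θ ↔ 0 ≤ x ∧ 0 ≤ y ∧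
      ∀ τ, IsStoppingTime (brownianFiltration W) τ →
        θ.I * (1 - meanDiscount W θ τ) ≤ θ.Q₁ / (θ.r - θ.α₁) * (1 - meanX W θ τ) * x
          + θ.Q₂ / (θ.r - θ.α₂) * (1 - meanY W θ τ) * y := by
  refine and_congr_right fun hx => and_congr_right fun hy => ?_
  rw [V_eq_F_iff (bddAbove_attainableValues hr h₁ h₂ hQ₁ hQ₂ hI hx hy)]
  refine forall₂_congr fun τ hτ => ?_
  rw [J_eq hr h₁ h₂ x y hτ, F_eq W h₁ h₂]
  constructor <;> intro h <;> linear_combination h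

/-- Joins the half-plane description to the one-product results. Monotonicity comes from `meanX` and
`meanY` being at most `1`; on an axis one of the two revenue terms drops out. -/
lemma isConvexUpperSet_stoppingRegion (hσ₁ : 0 < θ.σ₁) (hσ₂ : 0 < θ.σ₂) (hr : 0 < θ.r)
    (h₁ : θ.α₁ < θ.r) (h₂ : θ.α₂ < θ.r) (hQ₁ : 0 < θ.Q₁) (hQ₂ : 0 < θ.Q₂) (hI : 0 < θ.I)
    {β₁ η₁ : ℝ} (hβ₁ : IsPositiveCharRoot θ.α₁ θ.σ₁ θ.r β₁)
    (hη₁ : IsPositiveCharRoot θ.α₂ θ.σ₂ θ.r η₁) :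
    IsConvexUpperSet (stoppingRegion W θ) (threshold θ.α₁ θ.r θ.Q₁ θ.I β₁)
      (threshold θ.α₂ θ.r θ.Q₂ θ.I η₁) := by
  have hmem := fun x y : ℝ => mem_stoppingRegion_iff (W := W) (x := x) (y := y)
    hr h₁ h₂ hQ₁ hQ₂ hI
  have hβ := one_lt_of_isPositiveCharRoot hr h₁ hβ₁
  have hη := one_lt_of_isPositiveCharRoot hr h₂ hη₁
  have hS : stoppingRegion W θ = {p | 0 ≤ p.1} ∩ {p | 0 ≤ p.2} ∩
      ⋂ τ, ⋂ (_ : IsStoppingTime (brownianFiltration W) τ),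
        {p : ℝ × ℝ | θ.I * (1 - meanDiscount W θ τ) ≤
          θ.Q₁ / (θ.r - θ.α₁) * (1 - meanX W θ τ) * p.1
            + θ.Q₂ / (θ.r - θ.α₂) * (1 - meanY W θ τ) * p.2} := by
    ext ⟨x, y⟩
    rw [hmem, mem_inter_iff, mem_inter_iff, mem_iInter₂, and_assoc]
    rfl
  have hX := threshold_pos h₁ hQ₁ hI hβ
  have hY := threshold_pos h₂ hQ₂ hI hη
  refine ⟨fun p hp => ⟨hp.1, hp.2.1⟩, ?_, ?_, ?_, ?_, ?_, hX, hY⟩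
  · rw [convex_iff_forall_pos]
    rintro ⟨x, y⟩ hp ⟨x', y'⟩ hp' s t hs ht hst
    rw [hmem] at hp hp'
    refine (hmem _ _).2 ⟨?_, ?_, fun τ hτ => ?_⟩
    · exact add_nonneg (mul_nonneg hs.le hp.1) (mul_nonneg ht.le hp'.1)
    · exact add_nonneg (mul_nonneg hs.le hp.2.1) (mul_nonneg ht.le hp'.2.1)
    · have e := mul_le_mul_of_nonneg_left (hp.2.2 τ hτ) hs.le
      have e' := mul_le_mul_of_nonneg_left (hp'.2.2 τ hτ) ht.le
      change _ ≤ _ * (s * x + t * x') + _ * (s * y + t * y')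
      linear_combination e + e' - θ.I * (1 - meanDiscount W θ τ) * hst
  · rw [hS]
    refine ((isClosed_le continuous_const continuous_fst).inter
      (isClosed_le continuous_const continuous_snd)).inter
      (isClosed_iInter fun τ => isClosed_iInter fun _ => ?_)
    exact isClosed_le continuous_const (by fun_prop)
  · intro x y x' y' hp hxx' hyy'
    rw [hmem] at hp ⊢
    refine ⟨hp.1.trans hxx', hp.2.1.trans hyy', fun τ hτ => (hp.2.2 τ hτ).trans ?_⟩
    have e1 : 0 ≤ θ.Q₁ / (θ.r - θ.α₁) * (1 - meanX W θ τ) :=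
      mul_nonneg (div_nonneg hQ₁.le (sub_pos.2 h₁).le)
        (sub_nonneg.2 (integrable_meanX h₁ hτ).2)
    have e2 : 0 ≤ θ.Q₂ / (θ.r - θ.α₂) * (1 - meanY W θ τ) :=
      mul_nonneg (div_nonneg hQ₂.le (sub_pos.2 h₂).le)
        (sub_nonneg.2 (integrable_meanY h₂ hτ).2)
    gcongr
  · refine (hmem _ _).2 ⟨hX.le, le_rfl, fun τ hτ => ?_⟩
    have := integral_payoff_le_of_threshold_le (isBrownianWrt_WX W) hσ₁ hr h₁ hI hβ₁
      ((threshold_le_iff h₁ hQ₁ hβ).1 le_rfl) hτ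
    rw [← meanX, ← meanDiscount] at this
    linear_combination this
  · intro y hy
    rw [threshold_le_iff h₂ hQ₂ hη]
    have hw : 0 ≤ θ.Q₂ * y / (θ.r - θ.α₂) :=
      div_nonneg (mul_nonneg hQ₂.le hy) (sub_pos.2 h₂).le
    constructor
    · intro hp
      by_contra! hcon
      obtain ⟨τ, hτ, hgt⟩ := exists_integral_payoff_gt_of_lt_threshold (isBrownianWrt_WY W)
        brownianFiltration_congr hr h₂ hI hη₁ hw hcon
      -- The zeroth power is the bare discount factor, whichever motion it is written with.
      rw [discountedPower_zero θ.α₂ θ.σ₂ θ.α₁ θ.σ₁ θ.r W.WY W.WX, ← meanY, ← meanDiscount] at hgt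
      have := ((hmem _ _).1 hp).2.2 τ hτ
      have e : θ.Q₂ / (θ.r - θ.α₂) * (1 - meanY W θ τ) * y =
        θ.Q₂ * y / (θ.r - θ.α₂) * (1 - meanY W θ τ) := by ring
      rw [e] at this
      linarith
    · intro hle
      refine (hmem _ _).2 ⟨le_rfl, hy, fun τ hτ => ?_⟩
      have := integral_payoff_le_of_threshold_le (isBrownianWrt_WY W) hσ₂ hr h₂ hI hη₁ hle hτ
      rw [discountedPower_zero θ.α₂ θ.σ₂ θ.α₁ θ.σ₁ θ.r W.WY W.WX, ← meanY, ← meanDiscount] at this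
      linear_combination this

lemma continuationSection_eq (hr : 0 < θ.r) (h₁ : θ.α₁ < θ.r) (h₂ : θ.α₂ < θ.r)
    (hQ₁ : 0 < θ.Q₁) (hQ₂ : 0 < θ.Q₂) (hI : 0 < θ.I) {x : ℝ} (hx : 0 ≤ x) :
    continuationSection W θ x = {y | 0 ≤ y ∧ (x, y) ∉ stoppingRegion W θ} := by
  ext y
  refine and_congr_right fun hy => ?_
  have hbdd := bddAbove_attainableValues (W := W) hr h₁ h₂ hQ₁ hQ₂ hI hx hy
  have hle : F W θ x y ≤ V W θ x y := le_csSup hbdd (F_mem_attainableValues W θ x y)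
  constructor
  · exact fun h hS => h.ne' hS.2.2
  · exact fun h => lt_of_le_of_ne hle fun e => h ⟨hx, hy, e.symm⟩

end Model

end IrreversibleInvestment

end

/-! ### The stopping region and its boundary -/

theorem mainTheorem10 {Ω : Type*} [MeasurableSpace Ω] (P : Measure Ω) [IsProbabilityMeasure P]
    [P.IsComplete] (W : IrreversibleInvestment.PlanarBrownianMotion P)
    (θ : IrreversibleInvestment.Params)
    (hσ₁ : 0 < θ.σ₁) (hσ₂ : 0 < θ.σ₂) (hr : 0 < θ.r) (hα : max θ.α₁ θ.α₂ < θ.r)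
    (hQ₁ : 0 < θ.Q₁) (hQ₂ : 0 < θ.Q₂) (hI : 0 < θ.I)
    (β₁ η₁ : ℝ)
    (hβ₁ : IrreversibleInvestment.IsPositiveCharRoot θ.α₁ θ.σ₁ θ.r β₁)
    (hη₁ : IrreversibleInvestment.IsPositiveCharRoot θ.α₂ θ.σ₂ θ.r η₁) :
    -- the expectations, the integrals and the suprema that define `F`, `V` and `b` are genuine
    (∀ x y : ℝ, 0 ≤ x → 0 ≤ y →
      Integrable (fun p : Ω × ℝ => IrreversibleInvestment.discountedRevenue W θ x y p.2 p.1)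
        (P.prod (volume.restrict (Ioi (0 : ℝ)))) ∧
      (∀ τ : Ω → WithTop ℝ≥0,
        IsStoppingTime (IrreversibleInvestment.brownianFiltration W) τ →
          Integrable (IrreversibleInvestment.stoppedPayoff W θ x y τ) P) ∧
      BddAbove (IrreversibleInvestment.attainableValues W θ x y)) ∧
    (∀ x : ℝ, 0 ≤ x → BddAbove (IrreversibleInvestment.continuationSection W θ x)) ∧
    -- the stopping region is convex, and it is the epigraph of `b`
    Convex ℝ (IrreversibleInvestment.stoppingRegion W θ) ∧
    IrreversibleInvestment.stoppingRegion W θ =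
      {p : ℝ × ℝ | 0 ≤ p.1 ∧ 0 ≤ p.2 ∧ IrreversibleInvestment.boundary W θ p.1 ≤ p.2} ∧
    -- the boundary is convex and continuous
    ConvexOn ℝ (Ici (0 : ℝ)) (IrreversibleInvestment.boundary W θ) ∧
    ContinuousOn (IrreversibleInvestment.boundary W θ) (Ici (0 : ℝ)) ∧
    -- its values on the axes
    IrreversibleInvestment.boundary W θ 0 =
      IrreversibleInvestment.threshold θ.α₂ θ.r θ.Q₂ θ.I η₁ ∧
    (∀ x : ℝ, 0 < x → IrreversibleInvestment.boundary W θ x <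
      IrreversibleInvestment.threshold θ.α₂ θ.r θ.Q₂ θ.I η₁) ∧
    (∀ x : ℝ, IrreversibleInvestment.threshold θ.α₁ θ.r θ.Q₁ θ.I β₁ ≤ x →
      IrreversibleInvestment.boundary W θ x = 0) := by
  obtain ⟨h₁, h₂⟩ := max_lt_iff.1 hα
  have hS := IrreversibleInvestment.isConvexUpperSet_stoppingRegion (W := W) hσ₁ hσ₂ hr h₁ h₂
    hQ₁ hQ₂ hI hβ₁ hη₁
  have hsec : ∀ x : ℝ, 0 ≤ x → IrreversibleInvestment.continuationSection W θ x =
      {y | 0 ≤ y ∧ (x, y) ∉ IrreversibleInvestment.stoppingRegion W θ} := fun x hx =>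
    IrreversibleInvestment.continuationSection_eq hr h₁ h₂ hQ₁ hQ₂ hI hx
  have hb : ∀ x : ℝ, 0 ≤ x → IrreversibleInvestment.boundary W θ x =
      IrreversibleInvestment.lowerBoundary (IrreversibleInvestment.stoppingRegion W θ) x :=
    fun x hx => congrArg sSup (hsec x hx)
  have hEq : EqOn (IrreversibleInvestment.lowerBoundary
      (IrreversibleInvestment.stoppingRegion W θ)) (IrreversibleInvestment.boundary W θ)
      (Ici 0) := fun x hx => (hb x hx).symm
  refine ⟨fun x y hx hy => ⟨IrreversibleInvestment.integrable_discountedRevenue W h₁ h₂ x y,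
    fun τ hτ => IrreversibleInvestment.integrable_stoppedPayoff hr h₁ h₂ x y hτ,
    IrreversibleInvestment.bddAbove_attainableValues hr h₁ h₂ hQ₁ hQ₂ hI hx hy⟩,
    fun x hx => ?_, hS.convex, ?_, hS.convexOn.congr hEq, hS.continuousOn.congr hEq.symm, ?_,
    fun x hx => ?_, fun x hx => ?_⟩
  · rw [hsec x hx]
    exact hS.bddAbove hx
  · ext ⟨x, y⟩
    rw [hS.mem_iff]
    exact and_congr_right fun hx => by rw [hb x hx]
  · rw [hb 0 le_rfl, hS.apply_zero]
  · rw [hb x hx.le]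
    exact hS.lt_right hx
  · rw [hb x (hS.left_pos.le.trans hx), hS.eq_zero hx]
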